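/- Let $q\ge 1$ and $p\ge q$ be integers, and let $d_{ij}=d_{ji}\ge 0$ and $r_{ij}=r_{ji}\ge 0$ ($1\le i,j\le p$, $d_{ii}=r_{ii}=0$) be real weights. Let $D,R\in\mathbb{R}^{p\times p}$ be the corresponding Laplacians, i.e. $D_{ii}=\sum_j d_{ij}$, $D_{ij}=-d_{ij}$ for $i\ne j$, and likewise $R$ from $(r_{ij})$. Then there is exactly one matrix $\Gamma\in\mathbb{C}^{q\times q}$, the Schur complement of $D+\mathrm{j}R$ with respect to the first $q$ indices, such that $$(D+\mathrm{j}R)\begin{bmatrix} I_q\\ E\end{bmatrix}=\begin{bmatrix}\Gamma\\ 0\end{bmatrix}\quad\text{for some } E\in\mathbb{C}^{(p-q)\times q}.$$ Let further $n\ge 1$, let $M,K\in\mathbb{R}^{n\times n}$ be symmetric positive definite, and let $B\in\mathbb{R}^{n\times 1}$ be such that $M\ddot x+Kx=Bu$ is controllable from $u$ (equivalently, observable from $y=B^Tx$), that is, $$\operatorname{rank}\begin{bmatrix}K-\omega^2M\\ B^T\end{bmatrix}=n\quad\text{for all real } \omega>0 .$$ Consider the $q$ coupled oscillators $$M\ddot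 x_i+Kx_i=Bu_i,\qquad y_i=B^Tx_i,\qquad z_i=y_i,\qquad u_i+\sum_{j=1}^p d_{ij}(\dot z_i-\dot z_j)+\sum_{j=1}^p r_{ij}(z_i-z_j)=0\qquad (1\le i\le q),$$ $$\sum_{j=1}^p d_{ij}(\dot z_i-\dot z_j)+\sum_{j=1}^p r_{ij}(z_i-z_j)=0\qquad (q<i\le p),$$ with $x_i(t)\in\mathbb{R}^n$, $u_i(t),y_i(t),z_i(t)\in\mathbb{R}$ and $t\ge 0$. Say that the array synchronizes if every solution satisfies $\|x_i(t)-x_j(t)\|\to 0$ as $t\to\infty$ for all $i,j\in\{1,\dots,q\}$. Then, for $q\ge 2$, the array synchronizes if and only if $\operatorname{Re}\lambda_2(\Gamma)>0$, where $\lambda_1(\Gamma),\dots,\lambda_q(\Gamma)$ are the eigenvalues of $\Gamma$ counted with algebraic multiplicity and ordered so that $\operatorname{Re}\lambda_1(\Gamma)\le\dots\le\operatorname{Re}\lambda_q(\Gamma)$. Equivalently (and for every $q\ge 1$), the array synchronizes if and only if $\Gamma$ has exactly one eigenvalue on the imaginary axis, counted with algebraic multiplicity. In particular, for a given network, whether the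 array synchronizes does not depend on the oscillator data $n$, $M$, $K$, $B$. -/

import Mathlib

namespace OscNet

open Matrix Filter Topology

/-- The Laplacian matrix of the weights `w`: its diagonal entries are `∑ j, w i j` and its
off-diagonal entries are `- w i j` (the weights satisfy `w i i = 0`). -/
def lap {V : Type} [Fintype V] [DecidableEq V] (w : V → V → ℝ) : Matrix V V ℝ :=
  Matrix.diagonal (fun i => ∑ j, w i j) - Matrix.of w

/-- Admissible coupling weights: symmetric, nonnegative, and zero on the diagonal. -/
structure IsWeight {V : Type} (w : V → V → ℝ) : Prop where
  symm : ∀ i j, w i j = w j i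
  nonneg : ∀ i j, 0 ≤ w i j
  diag : ∀ i, w i i = 0

/-- The complex-valued Laplacian `D + jR`, with `D = lap d` and `R = lap r`. -/
noncomputable def complexLap {V : Type} [Fintype V] [DecidableEq V] (d r : V → V → ℝ) :
    Matrix V V ℂ :=
  (lap d).map Complex.ofReal + Complex.I • (lap r).map Complex.ofReal

/-- `Y` is a Schur complement of `X` with respect to the first `q` of the `q + m` indices:
`X [I; E] = [Y; 0]` for some matrix `E`. -/
def IsSchurComplement {q m : ℕ} (X : Matrix (Fin q ⊕ Fin m) (Fin q ⊕ Fin m) ℂ)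
    (Y : Matrix (Fin q) (Fin q) ℂ) : Prop :=
  ∃ E : Matrix (Fin m) (Fin q) ℂ,
    X * Matrix.fromRows (1 : Matrix (Fin q) (Fin q) ℂ) E =
      Matrix.fromRows Y (0 : Matrix (Fin m) (Fin q) ℂ)

/-- The real parts of the eigenvalues of `X`, counted with algebraic multiplicity, in
nondecreasing order. -/
noncomputable def eigReList {q : ℕ} (X : Matrix (Fin q) (Fin q) ℂ) : List ℝ :=
  (X.charpoly.roots.map Complex.re).sort (· ≤ ·)

theorem length_eigReList {q : ℕ} (X : Matrix (Fin q) (Fin q) ℂ) :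
    (eigReList X).length = q := by
  rw [eigReList, Multiset.length_sort, Multiset.card_map,
    IsAlgClosed.card_roots_eq_natDegree, Matrix.charpoly_natDegree_eq_dim, Fintype.card_fin]

/-- The real part of the `(k + 1)`-st smallest eigenvalue of `X`, the eigenvalues being ordered by
their real parts and counted with algebraic multiplicity (`k` starts from `0`). -/
noncomputable def reEig {q : ℕ} (X : Matrix (Fin q) (Fin q) ℂ) (k : Fin q) : ℝ :=
  (eigReList X).get (k.cast (length_eigReList X).symm)

/-- The number of eigenvalues of `X` on the imaginary axis, with algebraic multiplicity. -/
noncomputable def numImagEig {q : ℕ} (X : Matrix (Fin q) (Fin q) ℂ) : ℕ :=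
  (X.charpoly.roots.filter (fun z => z.re = 0)).card

/-- The rank condition expressing controllability of `M x'' + K x = B u` from `u`, equivalently
observability from `y = Bᵀ x`: `rank [K - ω² M; Bᵀ] = n` for all real `ω > 0`. -/
def IsObservable {n : ℕ} (M K : Matrix (Fin n) (Fin n) ℝ) (B : Matrix (Fin n) (Fin 1) ℝ) : Prop :=
  ∀ ω : ℝ, 0 < ω → (Matrix.fromRows (K - ω ^ 2 • M) Bᵀ).rank = n

/-- Oscillator data: `M`, `K` symmetric positive definite of size `n ≥ 1`, with the
controllability (observability) condition. -/
structure IsOscillator {n : ℕ} (M K : Matrix (Fin n) (Fin n) ℝ) (B : Matrix (Fin n) (Fin 1) ℝ) :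
    Prop where
  pos : 0 < n
  posDef_M : M.PosDef
  posDef_K : K.PosDef
  observable : IsObservable M K B

/-- A solution, on the time interval `[0, ∞)`, of the array of `q` oscillators coupled through the
network with boundary nodes `Sum.inl i` and interior nodes `Sum.inr k`. Here `x'`, `x''` and `z'`
are the time derivatives of `x`, `x'` and `z` (one-sided at `t = 0`). -/
structure IsSolution {q m n : ℕ} (d r : Fin q ⊕ Fin m → Fin q ⊕ Fin m → ℝ)
    (M K : Matrix (Fin n) (Fin n) ℝ) (B : Matrix (Fin n) (Fin 1) ℝ)
    (x x' x'' : Fin q → ℝ → Fin n → ℝ) (u y : Fin q → ℝ → ℝ)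
    (z z' : Fin q ⊕ Fin m → ℝ → ℝ) : Prop where
  deriv_x : ∀ i, ∀ t, 0 ≤ t → HasDerivWithinAt (x i) (x' i t) (Set.Ici 0) t
  deriv_x' : ∀ i, ∀ t, 0 ≤ t → HasDerivWithinAt (x' i) (x'' i t) (Set.Ici 0) t
  deriv_z : ∀ k, ∀ t, 0 ≤ t → HasDerivWithinAt (z k) (z' k t) (Set.Ici 0) t
  oscillator : ∀ i, ∀ t, 0 ≤ t → M *ᵥ x'' i t + K *ᵥ x i t = B *ᵥ ![u i t]
  output : ∀ i, ∀ t, 0 ≤ t → ![y i t] = Bᵀ *ᵥ x i t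
  boundary : ∀ i, ∀ t, 0 ≤ t →
    u i t + ∑ l, d (Sum.inl i) l * (z' (Sum.inl i) t - z' l t)
      + ∑ l, r (Sum.inl i) l * (z (Sum.inl i) t - z l t) = 0
  interior : ∀ k, ∀ t, 0 ≤ t →
    ∑ l, d (Sum.inr k) l * (z' (Sum.inr k) t - z' l t)
      + ∑ l, r (Sum.inr k) l * (z (Sum.inr k) t - z l t) = 0
  attach : ∀ i, ∀ t, 0 ≤ t → z (Sum.inl i) t - y i t = 0

/-- The coupled array synchronizes: along every solution, `‖x i t - x j t‖ → 0` as `t → ∞` for all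
`i`, `j`. (All norms on `ℝⁿ` give the same notion.) -/
def Synchronizes {q m n : ℕ} (d r : Fin q ⊕ Fin m → Fin q ⊕ Fin m → ℝ)
    (M K : Matrix (Fin n) (Fin n) ℝ) (B : Matrix (Fin n) (Fin 1) ℝ) : Prop :=
  ∀ (x x' x'' : Fin q → ℝ → Fin n → ℝ) (u y : Fin q → ℝ → ℝ) (z z' : Fin q ⊕ Fin m → ℝ → ℝ),
    IsSolution d r M K B x x' x'' u y z z' →
      ∀ i j, Tendsto (fun t => ‖x i t - x j t‖) atTop (𝓝 0)

end OscNet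

/-!
The complex power `w* (D + jR) w = w* D w + j w* R w` of a potential `w` has nonnegative real and
imaginary parts, since Laplacians are positive semidefinite. Hence interior potentials without
interior current produce no boundary current, and by symmetry this makes the Schur complement `Γ`
exist and be unique (`existsUnique_isSchurComplement`). It also puts the numerical range of `Γ`
into the right half-plane. So the imaginary eigenvalues of `Γ` are semisimple, and since `Γ 1 = 0`,
both spectral conditions say that every eigenvector of `Γ` for an imaginary eigenvalue is constant
(`numImagEig_eq_one_iff`, `reEig_one_pos_iff`).

An eigenvector `v` with `Γ v = j l v`, `l` real, extends to a potential `w` with `D w = 0` and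
`R w = l [v; 0]`, and since `D`, `R` are real, its real and imaginary parts have the same property.
For real `w` the array can then oscillate forever as `x i = v i cos (ω t) e`, where `e` is a mode
of `M x'' + (K + l B Bᵀ) x = 0`. Thus synchronization forces `v` to be constant
(`Synchronizes.eq_of_lap_mulVec`).

Conversely, the energy `½ ∑ (xᵀ K x + x'ᵀ M x') + ½ zᵀ R z` decreases at the rate `z'ᵀ D z'`. The
array is an implicit system: neither the potentials nor their derivatives are determined by the
oscillators. In energy coordinates, however, the velocity is a linear function of the state along
each trajectory, just because the system is dissipative; so the trajectory is `e ^ (tA)` applied to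
its initial state, where `A` is dissipative, and any output that vanishes on the imaginary
eigenvectors of `A` tends to zero (`tendsto_of_dissipative`). The imaginary eigenvectors are the
undamped modes of the array, and in such a mode the vector of the `Bᵀ x i` is an eigenvector of `Γ`
for an imaginary eigenvalue. If these are constant, observability makes the `x i` equal
(`IsNetworkState.eq_of_imaginary`).
-/

namespace OscNet

open Matrix Filter Topology

/-! ### Exponentials of operators with spectrum in the closed left half-plane -/

/-- If `ker (g ∘ g) = ker g`, then the kernel of every power of `g` lies in `ker g`; at `k = 0` the
hypothesis says `v = 0`. -/
theorem eq_zero_of_pow_apply_eq_zero {E : Type*} [AddCommGroup E] [Module ℂ E]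
    {g : Module.End ℂ E} (hg : ∀ v, g (g v) = 0 → g v = 0) (k : ℕ) (v : E)
    (hv : (g ^ k) v = 0) : g v = 0 := by
  induction k with
  | zero =>
    have : v = 0 := hv
    rw [this, map_zero]
  | succ l ih =>
    rw [pow_succ', Module.End.mul_apply] at hv
    cases l with
    | zero => exact hv
    | succ l =>
      apply ih
      rw [pow_succ', Module.End.mul_apply] at hv ⊢
      exact hg _ hv

open NormedSpace in
/-- On a generalized eigenvector the exponential series of `t • A` is `e ^ (t μ)` times a finite
sum. -/
theorem exp_smul_apply_of_pow_sub_eq_zero {E : Type*} [NormedAddCommGroup E] [NormedSpace ℂ E]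
    [CompleteSpace E] (A : E →L[ℂ] E) (μ : ℂ) (v : E) (k : ℕ)
    (hv : ((A - μ • 1) ^ k) v = 0) (t : ℂ) :
    exp (t • A) v =
      Complex.exp (t * μ) • ∑ j ∈ Finset.range k, (t ^ j / j.factorial) • ((A - μ • 1) ^ j) v := by
  -- `t A` is the sum of the commuting operators `t μ` and `t (A - μ)`
  have h1 : t • A = (t * μ) • (1 : E →L[ℂ] E) + t • (A - μ • 1) := by
    rw [smul_sub, smul_smul]; abel
  have h2 : exp (t • A) = exp ((t * μ) • (1 : E →L[ℂ] E)) * exp (t • (A - μ • 1)) := by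
    rw [h1]
    let : NormedAlgebra ℚ (E →L[ℂ] E) := NormedAlgebra.restrictScalars ℚ ℂ _
    exact NormedSpace.exp_add_of_commute ((Commute.one_left _).smul_left _)
  have h3 : exp ((t * μ) • (1 : E →L[ℂ] E)) = Complex.exp (t * μ) • 1 := by
    rw [← Algebra.algebraMap_eq_smul_one, ← Algebra.algebraMap_eq_smul_one,
      Complex.exp_eq_exp_ℂ, algebraMap_exp_comm]
  have h4 : HasSum (fun j : ℕ => (t ^ j / j.factorial) • ((A - μ • 1) ^ j) v)
      (exp (t • (A - μ • 1)) v) := by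
    have := (exp_series_hasSum_exp' (𝕂 := ℂ) (t • (A - μ • 1))).mapL
      (ContinuousLinearMap.apply ℂ E v)
    have he : (fun j : ℕ => (t ^ j / j.factorial) • ((A - μ • 1) ^ j) v) =
        fun j : ℕ => ContinuousLinearMap.apply ℂ E v
          ((j.factorial⁻¹ : ℂ) • (t • (A - μ • 1)) ^ j) := by
      ext j
      simp [smul_pow, smul_smul, div_eq_inv_mul]
    rw [he]
    exact this
  have h5 : HasSum (fun j : ℕ => (t ^ j / j.factorial) • ((A - μ • 1) ^ j) v)
      (∑ j ∈ Finset.range k, (t ^ j / j.factorial) • ((A - μ • 1) ^ j) v) := by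
    refine hasSum_sum_of_ne_finset_zero fun j hj => ?_
    obtain ⟨l, rfl⟩ := Nat.exists_eq_add_of_le (not_lt.1 (Finset.mem_range.not.1 hj))
    rw [add_comm, pow_add _ l k, pow_add _ l k, mul_apply_eq_comp, hv, map_zero, smul_zero]
  rw [h2, h3, ← h4.unique h5, smul_one_mul]
  rfl

theorem tendsto_cexp_mul_pow {μ : ℂ} (hμ : μ.re < 0) (j : ℕ) :
    Tendsto (fun t : ℝ => Complex.exp (t * μ) * (t : ℂ) ^ j) atTop (𝓝 0) := by
  rw [tendsto_zero_iff_norm_tendsto_zero]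
  have h := tendsto_rpow_mul_exp_neg_mul_atTop_nhds_zero j (-μ.re) (by linarith)
  refine h.congr' ?_
  filter_upwards [eventually_ge_atTop 0] with t ht
  simp [Complex.norm_exp, abs_of_nonneg ht, mul_comm]

open NormedSpace in
/-- If the spectrum of `A` lies in the closed left half-plane, its imaginary eigenvalues are
semisimple, and `C` kills the eigenvectors for imaginary eigenvalues, then `C e ^ (tA) → 0`
pointwise. The vectors for which this holds form a subspace, and it contains every generalized
eigenspace. -/
theorem tendsto_exp_smul_apply {E F : Type*} [NormedAddCommGroup E] [NormedSpace ℂ E]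
    [FiniteDimensional ℂ E] [NormedAddCommGroup F] [NormedSpace ℂ F] (A : E →L[ℂ] E)
    (C : E →L[ℂ] F) (hre : ∀ (μ : ℂ) v, v ≠ 0 → A v = μ • v → μ.re ≤ 0)
    (hss : ∀ (μ : ℂ) v, μ.re = 0 → (A - μ • 1) ((A - μ • 1) v) = 0 → (A - μ • 1) v = 0)
    (hC : ∀ (μ : ℂ) v, μ.re = 0 → A v = μ • v → C v = 0) (v : E) :
    Tendsto (fun t : ℝ => C (exp ((t : ℂ) • A) v)) atTop (𝓝 0) := by
  have : CompleteSpace E := FiniteDimensional.complete ℂ E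
  let W : Submodule ℂ E :=
    { carrier := {v | Tendsto (fun t : ℝ => C (exp ((t : ℂ) • A) v)) atTop (𝓝 0)}
      add_mem' := fun {a b} ha hb => by simpa using ha.add hb
      zero_mem' := by simp
      smul_mem' := fun c a ha => by simpa using ha.const_smul c }
  suffices hW : W = ⊤ by
    have : v ∈ W := hW ▸ Submodule.mem_top
    exact this
  rw [eq_top_iff, ← Module.End.iSup_maxGenEigenspace_eq_top (A : Module.End ℂ E)]
  refine iSup_le fun μ v hv => ?_
  obtain ⟨k, hk⟩ := (Module.End.mem_maxGenEigenspace _ _ _).1 hv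
  have hk' : ((A - μ • 1 : E →L[ℂ] E) ^ k) v = 0 := by
    rw [← hk]
    have : ((A : Module.End ℂ E) - μ • 1) = ((A - μ • 1 : E →L[ℂ] E) : Module.End ℂ E) := rfl
    rw [this, ← ContinuousLinearMap.toLinearMap_pow]; rfl
  change Tendsto (fun t : ℝ => C (exp ((t : ℂ) • A) v)) atTop (𝓝 0)
  by_cases hv0 : v = 0
  · simp [hv0]
  -- a generalized eigenvector forces an eigenvector, so `μ` has nonpositive real part
  have hμ : μ.re ≤ 0 := by
    classical
    have hex : ∃ k : ℕ, ((A - μ • 1 : E →L[ℂ] E) ^ k) v = 0 := ⟨k, hk'⟩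
    have hpos : Nat.find hex ≠ 0 := fun h => hv0 (by
      have := Nat.find_spec hex
      rwa [h, pow_zero] at this)
    obtain ⟨l, hl⟩ := Nat.exists_eq_succ_of_ne_zero hpos
    have hne := Nat.find_min hex (m := l) (by omega)
    have hsp := Nat.find_spec hex
    rw [hl, pow_succ', mul_apply_eq_comp] at hsp
    exact hre μ _ hne (by simpa [sub_eq_zero] using hsp)
  rcases hμ.lt_or_eq with hlt | heq
  · simp only [exp_smul_apply_of_pow_sub_eq_zero A μ v k hk', map_smul, map_sum, Finset.smul_sum,
      smul_smul]
    rw [← Finset.sum_const_zero (s := Finset.range k)]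
    refine tendsto_finsetSum _ fun j _ => ?_
    have := ((tendsto_cexp_mul_pow hlt j).div_const (j.factorial : ℂ)).smul_const
      (C (((A - μ • 1) ^ j) v))
    simpa [mul_div_assoc] using this
  · have h1 : (A - μ • 1) v = 0 :=
      eq_zero_of_pow_apply_eq_zero (g := (A : Module.End ℂ E) - μ • 1) (fun w => hss μ w heq) k v hk
    have h2 := fun t => exp_smul_apply_of_pow_sub_eq_zero A μ v 1 (by simpa using h1) t
    have h3 := hC μ v heq (by simpa [sub_eq_zero] using h1)
    refine tendsto_const_nhds.congr fun t : ℝ => ?_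
    rw [h2]
    simp [h3]

open NormedSpace in
/-- A solution of `f' = A f` on `[0, ∞)` is `t ↦ e ^ (tA) (f 0)`. -/
theorem eq_exp_smul_apply_of_hasDerivWithinAt {E : Type*} [NormedAddCommGroup E] [NormedSpace ℂ E]
    [CompleteSpace E] (A : E →L[ℂ] E) (f : ℝ → E)
    (hf : ∀ t, 0 ≤ t → HasDerivWithinAt f (A (f t)) (Set.Ici 0) t) (t : ℝ) (ht : 0 ≤ t) :
    f t = exp ((t : ℂ) • A) (f 0) := by
  have hexp : ∀ t : ℝ, HasDerivAt (fun t : ℝ => exp ((t : ℂ) • A) (f 0))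
      (A (exp ((t : ℂ) • A) (f 0))) t := by
    intro t
    have h := (hasDerivAt_exp_smul_const' (𝕂 := ℂ) A (t : ℂ)).scomp t
      Complex.ofRealCLM.hasDerivAt
    have h' := ((ContinuousLinearMap.apply ℂ E (f 0)).restrictScalars ℝ).hasFDerivAt.comp_hasDerivAt
      t h
    simpa [Function.comp_def] using h'
  refine ODE_solution_unique (v := fun _ x => A x) (K := ‖A‖₊) (a := 0) (b := t)
    (g := fun t : ℝ => exp ((t : ℂ) • A) (f 0)) (fun _ => A.lipschitz) ?_ ?_ ?_ ?_ ?_ ⟨ht, le_rfl⟩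
  · exact fun x hx => ((hf x hx.1).continuousWithinAt).mono Set.Icc_subset_Ici_self
  · exact fun x hx => (hf x hx.1).mono (Set.Ici_subset_Ici.2 hx.1)
  · exact fun x _ => (hexp x).continuousAt.continuousWithinAt
  · exact fun x _ => (hexp x).hasDerivWithinAt
  · simp

/-! ### Dissipative implicit linear systems -/

theorem re_star_dotProduct_self_pos {ι : Type*} [Fintype ι] {v : ι → ℂ} (hv : v ≠ 0) :
    0 < (star v ⬝ᵥ v).re := by
  open ComplexOrder in
  exact (Complex.pos_iff.1 (Matrix.dotProduct_star_self_pos_iff.2 hv)).1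

theorem im_star_dotProduct_self {ι : Type*} [Fintype ι] (v : ι → ℂ) :
    (star v ⬝ᵥ v).im = 0 := by
  open ComplexOrder in
  exact (Complex.nonneg_iff.1 (dotProduct_star_self_nonneg v)).2.symm

theorem eq_zero_of_forall_re_add_mul_nonpos {a : ℝ} {ι : Type*} [Fintype ι] {v : ι → ℂ}
    (h : ∀ c : ℝ, 0 ≤ c → a + c * (star v ⬝ᵥ v).re ≤ 0) : v = 0 := by
  by_contra hv
  have hpos := re_star_dotProduct_self_pos hv
  have := h ((|a| + 1) / (star v ⬝ᵥ v).re) (by positivity)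
  rw [div_mul_cancel₀ _ hpos.ne'] at this
  linarith [neg_abs_le a]

/-- There is no Jordan chain `A w = μ w`, `A v = μ v + w` with `μ` imaginary for a dissipative `A`:
along `v + c w` the form `Re ⟨·, A ·⟩` is affine in `c` with slope `‖w‖²`. -/
theorem eq_zero_of_dissipative_jordan {ι : Type*} [Fintype ι] {v w : ι → ℂ} {μ : ℂ}
    (hμ : μ.re = 0)
    (h : ∀ c : ℝ, (star (v + (c : ℂ) • w) ⬝ᵥ (μ • (v + (c : ℂ) • w) + w)).re ≤ 0) : w = 0 := by
  refine eq_zero_of_forall_re_add_mul_nonpos (a := (star v ⬝ᵥ w).re) fun c _ => ?_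
  have h0 : ∀ u : ι → ℂ, (star u ⬝ᵥ μ • u).re = 0 := fun u => by
    rw [dotProduct_smul, smul_eq_mul, Complex.mul_re, hμ, im_star_dotProduct_self]; simp
  have := h c
  rw [dotProduct_add, Complex.add_re, h0, zero_add] at this
  simpa [add_dotProduct, smul_dotProduct] using this

/-- An invariance principle for linear implicit systems `d/dt (φ s) = ψ s`. If the system is
dissipative and the output `C (φ s)` vanishes at every purely oscillating mode `ψ s = μ φ s`,
`Re μ = 0`, then the output of every trajectory tends to zero. Neither is `s` assumed regular, nor
does `φ s` have to determine `s`: on the span of the states `φ (s t)` of one trajectory,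
dissipativity alone turns the implicit system into a linear differential equation. -/
theorem tendsto_of_dissipative {ι : Type*} [Fintype ι] {S : Type*} [AddCommGroup S] [Module ℂ S]
    {F : Type*} [NormedAddCommGroup F] [NormedSpace ℂ F] (φ ψ : S →ₗ[ℂ] (ι → ℂ))
    (hdis : ∀ s, (star (φ s) ⬝ᵥ ψ s).re ≤ 0) (C : (ι → ℂ) →L[ℂ] F)
    (hC : ∀ (μ : ℂ) (s : S), μ.re = 0 → ψ s = μ • φ s → C (φ s) = 0) (s : ℝ → S)
    (hs : ∀ t, 0 ≤ t → HasDerivWithinAt (fun t => φ (s t)) (ψ (s t)) (Set.Ici 0) t) :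
    Tendsto (fun t => C (φ (s t))) atTop (𝓝 0) := by
  let T : Submodule ℂ (ι → ℂ) := Submodule.span ℂ ((fun t => φ (s t)) '' Set.Ici 0)
  have hφT : ∀ t, 0 ≤ t → φ (s t) ∈ T := fun t ht => Submodule.subset_span ⟨t, ht, rfl⟩
  -- a derivative stays in the closed subspace spanned by the values
  have hψT : ∀ t, 0 ≤ t → ψ (s t) ∈ T := by
    intro t ht
    have h1 := range_derivWithin_subset_closure_span_image (fun t => φ (s t))
      (s := Set.Ici (0 : ℝ)) (t := Set.Ici 0) (by simp) ⟨t, rfl⟩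
    rw [(hs t ht).derivWithin (uniqueDiffOn_Ici 0 t ht)] at h1
    have h2 : (Submodule.span ℝ ((fun t => φ (s t)) '' Set.Ici 0) : Set (ι → ℂ)) ⊆ T := by
      have : Submodule.span ℝ ((fun t => φ (s t)) '' Set.Ici 0) ≤ T.restrictScalars ℝ :=
        Submodule.span_le.2 Submodule.subset_span
      exact this
    exact closure_minimal h2 T.closed_of_finiteDimensional h1
  let S' : Submodule ℂ S := T.comap φ ⊓ T.comap ψ
  let φ' : S' →ₗ[ℂ] T := (φ.domRestrict S').codRestrict T fun a => a.2.1
  let ψ' : S' →ₗ[ℂ] T := (ψ.domRestrict S').codRestrict T fun a => a.2.2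
  have hsur : Function.Surjective φ' := by
    have h1 : T ≤ S'.map φ := by
      refine Submodule.span_le.2 ?_
      rintro _ ⟨t, ht, rfl⟩
      exact ⟨s t, ⟨hφT t ht, hψT t ht⟩, rfl⟩
    rintro ⟨v, hv⟩
    obtain ⟨a, ha, hav⟩ := h1 hv
    exact ⟨⟨a, ha⟩, Subtype.ext hav⟩
  -- Dissipativity makes the velocity a function of the state: if `φ a = 0`, choose `b` with
  -- `φ b = ψ a`; then `Re ⟨φ (b + c a), ψ (b + c a)⟩` is affine in `c` with slope `‖ψ a‖²`.
  have hker : ∀ a : S', φ' a = 0 → ψ' a = 0 := by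
    intro a ha
    have ha' : φ a = 0 := congrArg Subtype.val ha
    obtain ⟨b, hb⟩ := hsur (ψ' a)
    have hb' : φ b = ψ a := congrArg Subtype.val hb
    have : ψ a = 0 := by
      refine eq_zero_of_forall_re_add_mul_nonpos (a := (star (φ b) ⬝ᵥ ψ b).re) fun c _ => ?_
      have := hdis ((b : S) + (c : ℂ) • (a : S))
      simpa [ha', hb', dotProduct_add] using this
    exact Subtype.ext this
  obtain ⟨g, hg⟩ := φ'.exists_rightInverse_of_surjective (LinearMap.range_eq_top.2 hsur)
  have hg' : ∀ v, φ' (g v) = v := fun v => LinearMap.congr_fun hg v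
  let A₀ : T →ₗ[ℂ] T := ψ' ∘ₗ g
  have hA₀ : ∀ a, A₀ (φ' a) = ψ' a := by
    intro a
    have := hker (g (φ' a) - a) (by rw [map_sub, hg', sub_self])
    rwa [map_sub, sub_eq_zero] at this
  let A : T →L[ℂ] T := LinearMap.toContinuousLinearMap A₀
  have hA : ∀ a, A (φ' a) = ψ' a := hA₀
  have hAdis : ∀ v : T, (star (v : ι → ℂ) ⬝ᵥ (A v : ι → ℂ)).re ≤ 0 := by
    intro v
    obtain ⟨a, rfl⟩ := hsur v
    rw [hA]
    exact hdis a
  classical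
  let f : ℝ → T := fun t => if ht : 0 ≤ t then ⟨φ (s t), hφT t ht⟩ else 0
  have hf : ∀ t, 0 ≤ t → (f t : ι → ℂ) = φ (s t) := fun t ht => by simp [f, ht]
  have hfd : ∀ t, 0 ≤ t → HasDerivWithinAt f (A (f t)) (Set.Ici 0) t := by
    intro t ht
    have h1 : (A (f t) : ι → ℂ) = ψ (s t) := by
      have : f t = φ' ⟨s t, hφT t ht, hψT t ht⟩ := Subtype.ext (hf t ht)
      rw [this, hA]; rfl
    have h2 : HasDerivWithinAt (fun t => (f t : ι → ℂ)) (A (f t) : ι → ℂ) (Set.Ici 0) t := by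
      rw [h1]
      exact (hs t ht).congr (fun x hx => hf x hx) (hf t ht)
    rw [hasDerivWithinAt_iff_tendsto_slope] at h2 ⊢
    rw [tendsto_subtype_rng]
    simpa [slope_fun_def, Function.comp_def] using h2
  have hmain := tendsto_exp_smul_apply A (C ∘L T.subtypeL) ?_ ?_ ?_ (f 0)
  · refine hmain.congr' ?_
    filter_upwards [eventually_ge_atTop 0] with t ht
    rw [← eq_exp_smul_apply_of_hasDerivWithinAt A f hfd t ht]
    simp [hf t ht]
  · intro μ v hv hAv
    have h1 := hAdis v
    have hpos := re_star_dotProduct_self_pos (v := (v : ι → ℂ)) (by simpa using hv)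
    rw [hAv, Submodule.coe_smul, dotProduct_smul, smul_eq_mul, Complex.mul_re,
      im_star_dotProduct_self, mul_zero, sub_zero] at h1
    by_contra hcon
    nlinarith
  · intro μ v hμ hv
    set w := (A - μ • 1) v with hw
    have hAv : A v = μ • v + w := by simp [hw]
    have hAw : A w = μ • w := by
      simpa [sub_eq_zero] using hv
    refine Subtype.ext (eq_zero_of_dissipative_jordan (v := v) hμ fun c => ?_)
    have := hAdis (v + (c : ℂ) • w)
    have h2 : A (v + (c : ℂ) • w) = μ • (v + (c : ℂ) • w) + w := by
      rw [map_add, map_smul, hAv, hAw, smul_add, smul_comm]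
      abel
    rw [h2] at this
    exact this
  · intro μ v hμ hAv
    obtain ⟨a, rfl⟩ := hsur v
    rw [hA] at hAv
    exact hC μ a hμ (congrArg Subtype.val hAv)

/-! ### Laplacians and the Schur complement -/

open MatrixOrder in
theorem exists_eq_transpose_mul_self {V : Type*} [Fintype V] [DecidableEq V] {A : Matrix V V ℝ}
    (hA : A.PosSemidef) : ∃ L : Matrix V V ℝ, A = Lᵀ * L := by
  obtain ⟨L, hL⟩ := CStarAlgebra.nonneg_iff_eq_star_mul_self.1 hA.nonneg
  exact ⟨L, by rw [hL, star_eq_conjTranspose, conjTranspose_eq_transpose_of_trivial]⟩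

theorem isUnit_det_of_posDef {V : Type*} [Fintype V] [DecidableEq V] {A Q : Matrix V V ℝ}
    (hA : A.PosDef) (hQ : A = Qᵀ * Q) : IsUnit Q.det := by
  have h1 := hA.det_pos.ne'
  rw [hQ, det_mul] at h1
  exact (right_ne_zero_of_mul h1).isUnit

theorem map_ofReal_mul {ι κ ν : Type*} [Fintype κ] (A : Matrix ι κ ℝ) (C : Matrix κ ν ℝ) :
    (A * C).map Complex.ofReal = A.map Complex.ofReal * C.map Complex.ofReal := by
  ext i j
  simp [mul_apply]

theorem map_ofReal_transpose_mul_self {V : Type*} [Fintype V] (L : Matrix V V ℝ) :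
    (Lᵀ * L).map Complex.ofReal = (L.map Complex.ofReal)ᴴ * L.map Complex.ofReal := by
  rw [map_ofReal_mul]
  congr 1
  ext i j
  simp

open ComplexOrder in
theorem posSemidef_map_ofReal {V : Type*} [Fintype V] {A : Matrix V V ℝ}
    (hA : A.PosSemidef) : (A.map Complex.ofReal).PosSemidef := by
  classical
  obtain ⟨L, rfl⟩ := exists_eq_transpose_mul_self hA
  rw [map_ofReal_transpose_mul_self]
  exact posSemidef_conjTranspose_mul_self _

theorem re_star_dotProduct_mulVec_nonneg {V : Type*} [Fintype V] {A : Matrix V V ℝ}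
    (hA : A.PosSemidef) (v : V → ℂ) : 0 ≤ (star v ⬝ᵥ A.map Complex.ofReal *ᵥ v).re := by
  open ComplexOrder in
  exact (Complex.nonneg_iff.1 ((posSemidef_map_ofReal hA).dotProduct_mulVec_nonneg v)).1

theorem im_star_dotProduct_mulVec {V : Type*} [Fintype V] {A : Matrix V V ℝ}
    (hA : A.PosSemidef) (v : V → ℂ) : (star v ⬝ᵥ A.map Complex.ofReal *ᵥ v).im = 0 := by
  open ComplexOrder in
  exact (Complex.nonneg_iff.1 ((posSemidef_map_ofReal hA).dotProduct_mulVec_nonneg v)).2.symm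

theorem mulVec_eq_zero_of_re_eq_zero {V : Type*} [Fintype V] {A : Matrix V V ℝ}
    (hA : A.PosSemidef) {v : V → ℂ} (h : (star v ⬝ᵥ A.map Complex.ofReal *ᵥ v).re = 0) :
    A.map Complex.ofReal *ᵥ v = 0 := by
  open ComplexOrder in
  exact ((posSemidef_map_ofReal hA).dotProduct_mulVec_zero_iff v).1
    (Complex.ext h (im_star_dotProduct_mulVec hA v))

section Laplacian

variable {V : Type} [Fintype V] [DecidableEq V]

theorem lap_mulVec (w : V → V → ℝ) (x : V → ℝ) (i : V) :
    (lap w *ᵥ x) i = ∑ j, w i j * (x i - x j) := by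
  rw [lap, sub_mulVec, Pi.sub_apply, mulVec_diagonal]
  simp [mulVec, dotProduct, mul_sub, Finset.sum_mul]

theorem lap_map_mulVec (w : V → V → ℝ) (x : V → ℂ) (i : V) :
    ((lap w).map Complex.ofReal *ᵥ x) i = ∑ j, (w i j : ℂ) * (x i - x j) := by
  have : (lap w).map Complex.ofReal = Matrix.diagonal (fun i => ∑ j, (w i j : ℂ)) -
      Matrix.of fun i j => (w i j : ℂ) := by
    ext i j
    by_cases h : i = j
    · subst h; simp [lap]
    · simp [lap, h]
  rw [this, sub_mulVec, Pi.sub_apply, mulVec_diagonal]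
  simp [mulVec, dotProduct, mul_sub, Finset.sum_mul]

theorem IsWeight.lap_transpose {w : V → V → ℝ} (hw : IsWeight w) : (lap w)ᵀ = lap w := by
  ext i j
  by_cases h : i = j
  · subst h; rfl
  · simp [lap, h, Ne.symm h, hw.symm j i]

/-- The Dirichlet form of a weighted graph. -/
theorem IsWeight.dotProduct_lap_mulVec {w : V → V → ℝ} (hw : IsWeight w) (x : V → ℝ) :
    2 * (x ⬝ᵥ lap w *ᵥ x) = ∑ i, ∑ j, w i j * (x i - x j) ^ 2 := by
  have h1 : x ⬝ᵥ lap w *ᵥ x = ∑ i, ∑ j, w i j * (x i * (x i - x j)) := by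
    simp only [dotProduct, lap_mulVec, Finset.mul_sum]
    exact Finset.sum_congr rfl fun i _ => Finset.sum_congr rfl fun j _ => by ring
  have h2 : x ⬝ᵥ lap w *ᵥ x = ∑ i, ∑ j, w i j * (x j * (x j - x i)) := by
    rw [h1, Finset.sum_comm]
    exact Finset.sum_congr rfl fun i _ => Finset.sum_congr rfl fun j _ => by rw [hw.symm]
  rw [two_mul]
  nth_rewrite 1 [h1]
  rw [h2]
  simp only [← Finset.sum_add_distrib]
  exact Finset.sum_congr rfl fun i _ => Finset.sum_congr rfl fun j _ => by ring

theorem IsWeight.posSemidef_lap {w : V → V → ℝ} (hw : IsWeight w) : (lap w).PosSemidef := by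
  refine PosSemidef.of_dotProduct_mulVec_nonneg ?_ fun x => ?_
  · rw [IsHermitian, conjTranspose_eq_transpose_of_trivial, hw.lap_transpose]
  · have h1 := hw.dotProduct_lap_mulVec x
    have h2 : 0 ≤ ∑ i, ∑ j, w i j * (x i - x j) ^ 2 :=
      Finset.sum_nonneg fun i _ => Finset.sum_nonneg fun j _ =>
        mul_nonneg (hw.nonneg i j) (sq_nonneg _)
    rw [star_trivial]
    linarith

variable {d r : V → V → ℝ}

theorem complexLap_mulVec (d r : V → V → ℝ) (v : V → ℂ) :
    complexLap d r *ᵥ v =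
      (lap d).map Complex.ofReal *ᵥ v + Complex.I • (lap r).map Complex.ofReal *ᵥ v := by
  rw [complexLap, add_mulVec, smul_mulVec]

theorem complexLap_transpose (hd : IsWeight d) (hr : IsWeight r) :
    (complexLap d r)ᵀ = complexLap d r := by
  rw [complexLap, transpose_add, transpose_smul, ← transpose_map, ← transpose_map, hd.lap_transpose,
    hr.lap_transpose]

theorem complexLap_mulVec_one (d r : V → V → ℝ) : complexLap d r *ᵥ 1 = 0 := by
  rw [complexLap_mulVec]
  ext i
  simp [lap_map_mulVec]

theorem re_star_dotProduct_complexLap (hr : IsWeight r) (v : V → ℂ) :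
    (star v ⬝ᵥ complexLap d r *ᵥ v).re = (star v ⬝ᵥ (lap d).map Complex.ofReal *ᵥ v).re := by
  simp [complexLap_mulVec, dotProduct_add, im_star_dotProduct_mulVec hr.posSemidef_lap]

theorem im_star_dotProduct_complexLap (hd : IsWeight d) (v : V → ℂ) :
    (star v ⬝ᵥ complexLap d r *ᵥ v).im = (star v ⬝ᵥ (lap r).map Complex.ofReal *ᵥ v).re := by
  simp [complexLap_mulVec, dotProduct_add, im_star_dotProduct_mulVec hd.posSemidef_lap]

end Laplacian

/-- The Fredholm alternative for a complex symmetric (not Hermitian) matrix: the pairing is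
bilinear. -/
theorem exists_mulVec_eq_of_transpose_eq {ι : Type*} [Fintype ι] {A : Matrix ι ι ℂ} (hA : Aᵀ = A)
    {b : ι → ℂ} (h : ∀ c, A *ᵥ c = 0 → c ⬝ᵥ b = 0) : ∃ e, A *ᵥ e = b := by
  classical
  by_contra hcon
  have hb : b ∉ LinearMap.range A.mulVecLin := fun ⟨e, he⟩ => hcon ⟨e, he⟩
  obtain ⟨f, hfb, hf⟩ := Submodule.exists_le_ker_of_notMem hb
  have hfc : ∀ v, f v = (fun i => f (Pi.single i 1)) ⬝ᵥ v := by
    intro v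
    rw [LinearMap.pi_apply_eq_sum_univ f v, dotProduct]
    simp only [smul_eq_mul]
    refine Finset.sum_congr rfl fun i _ => ?_
    rw [mul_comm]
    congr 2
    ext j
    simp [Pi.single_apply, eq_comm]
  refine hfb ?_
  rw [hfc]
  refine h _ ?_
  rw [← hA, mulVec_transpose]
  refine (dotProduct_eq_zero_iff.1 fun v => ?_)
  rw [← dotProduct_mulVec, ← hfc]
  exact hf ⟨v, rfl⟩

section Schur

variable {q m : ℕ} {d r : Fin q ⊕ Fin m → Fin q ⊕ Fin m → ℝ}

/-- Interior potentials that produce no interior current produce no boundary current: the complex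
power `w* D w + j w* R w` of `w = [0; v]` vanishes, and both terms are nonnegative. This gives
existence as well as uniqueness of the Schur complement although the interior block may be
singular. -/
theorem eq_zero_of_complexLap_mulVec_elim_zero (hd : IsWeight d) (hr : IsWeight r)
    {v : Fin m → ℂ} {g : Fin q → ℂ}
    (h : complexLap d r *ᵥ Sum.elim 0 v = Sum.elim g 0) : g = 0 := by
  have h0 : star (Sum.elim (0 : Fin q → ℂ) v) ⬝ᵥ complexLap d r *ᵥ Sum.elim 0 v = 0 := by
    rw [h]
    simp [dotProduct]
  have hre := re_star_dotProduct_complexLap (d := d) hr (Sum.elim (0 : Fin q → ℂ) v)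
  have him := im_star_dotProduct_complexLap (r := r) hd (Sum.elim (0 : Fin q → ℂ) v)
  rw [h0] at hre him
  have h1 := mulVec_eq_zero_of_re_eq_zero hd.posSemidef_lap hre.symm
  have h2 := mulVec_eq_zero_of_re_eq_zero hr.posSemidef_lap him.symm
  rw [complexLap_mulVec, h1, h2, smul_zero, add_zero] at h
  ext i
  exact (congrFun h (Sum.inl i)).symm

theorem IsSchurComplement.exists_mulVec {X : Matrix (Fin q ⊕ Fin m) (Fin q ⊕ Fin m) ℂ}
    {Γ : Matrix (Fin q) (Fin q) ℂ} (h : IsSchurComplement X Γ) (v : Fin q → ℂ) :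
    ∃ e, X *ᵥ Sum.elim v e = Sum.elim (Γ *ᵥ v) 0 := by
  obtain ⟨E, hE⟩ := h
  refine ⟨E *ᵥ v, ?_⟩
  have := congrArg (· *ᵥ v) hE
  simpa [← mulVec_mulVec, fromRows_mulVec] using this

/-- `Γ` maps boundary potentials to boundary currents, whichever compatible interior potentials `e`
are used. -/
theorem IsSchurComplement.mulVec_eq (hd : IsWeight d) (hr : IsWeight r)
    {Γ : Matrix (Fin q) (Fin q) ℂ} (hΓ : IsSchurComplement (complexLap d r) Γ)
    {v g : Fin q → ℂ} {e : Fin m → ℂ}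
    (h : complexLap d r *ᵥ Sum.elim v e = Sum.elim g 0) : Γ *ᵥ v = g := by
  obtain ⟨e', he'⟩ := hΓ.exists_mulVec v
  have : complexLap d r *ᵥ Sum.elim 0 (e' - e) = Sum.elim (Γ *ᵥ v - g) 0 := by
    have h1 : Sum.elim (0 : Fin q → ℂ) (e' - e) = Sum.elim v e' - Sum.elim v e := by
      ext (i | i) <;> simp
    rw [h1, mulVec_sub, he', h]
    ext (i | i) <;> simp
  exact sub_eq_zero.1 (eq_zero_of_complexLap_mulVec_elim_zero hd hr this)

theorem existsUnique_isSchurComplement (hd : IsWeight d) (hr : IsWeight r) :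
    ∃! Γ : Matrix (Fin q) (Fin q) ℂ, IsSchurComplement (complexLap d r) Γ := by
  have hsymm := complexLap_transpose hd hr
  set X := complexLap d r with hX
  have hblk : X = fromBlocks X.toBlocks₁₁ X.toBlocks₁₂ X.toBlocks₂₁ X.toBlocks₂₂ :=
    (fromBlocks_toBlocks X).symm
  have h22 : X.toBlocks₂₂ᵀ = X.toBlocks₂₂ := by
    ext i j
    exact congrFun (congrFun hsymm (Sum.inr i)) (Sum.inr j)
  have hcol : ∀ j, ∃ e, X.toBlocks₂₂ *ᵥ e = -(X.toBlocks₂₁.col j) := by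
    intro j
    refine exists_mulVec_eq_of_transpose_eq h22 fun c hc => ?_
    have h1 : X *ᵥ Sum.elim 0 c = Sum.elim (X.toBlocks₁₂ *ᵥ c) 0 := by
      rw [hblk, fromBlocks_mulVec]
      simp [hc]
    have h2 := congrFun (eq_zero_of_complexLap_mulVec_elim_zero hd hr h1) j
    rw [dotProduct_neg, neg_eq_zero, dotProduct_comm]
    refine Eq.trans ?_ h2
    refine Finset.sum_congr rfl fun k _ => ?_
    congr 1
    exact congrFun (congrFun hsymm (Sum.inl j)) (Sum.inr k)
  choose e he using hcol
  let E : Matrix (Fin m) (Fin q) ℂ := of fun i j => e j i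
  have hE : X.toBlocks₂₂ * E = -X.toBlocks₂₁ := by
    ext i j
    exact congrFun (he j) i
  refine ⟨X.toBlocks₁₁ + X.toBlocks₁₂ * E, ⟨E, ?_⟩, ?_⟩
  · nth_rewrite 1 [hblk]
    rw [fromBlocks_mul_fromRows, hE, Matrix.mul_one, Matrix.mul_one, add_neg_cancel]
  · rintro Γ hΓ
    obtain ⟨E', hE'⟩ := hΓ
    refine ext_of_mulVec_single fun j => ?_
    refine IsSchurComplement.mulVec_eq hd hr ⟨E', hE'⟩ (e := E *ᵥ Pi.single j 1) ?_
    rw [← hX, hblk, fromBlocks_mulVec]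
    simp only [Sum.elim_comp_inl, Sum.elim_comp_inr, mulVec_mulVec, hE, neg_mulVec, add_mulVec,
      add_neg_cancel]
    simp

/-- The real part of the power at the boundary is the power dissipated in the network, hence is
nonnegative. -/
theorem re_star_dotProduct_schur (hd : IsWeight d) (hr : IsWeight r)
    {Γ : Matrix (Fin q) (Fin q) ℂ} (hΓ : IsSchurComplement (complexLap d r) Γ) (v : Fin q → ℂ) :
    0 ≤ (star v ⬝ᵥ Γ *ᵥ v).re := by
  obtain ⟨e, he⟩ := hΓ.exists_mulVec v
  have h1 : star (Sum.elim v e) ⬝ᵥ complexLap d r *ᵥ Sum.elim v e = star v ⬝ᵥ Γ *ᵥ v := by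
    rw [he]
    simp [dotProduct]
  rw [← h1, re_star_dotProduct_complexLap hr]
  exact re_star_dotProduct_mulVec_nonneg hd.posSemidef_lap _

theorem schur_mulVec_one (hd : IsWeight d) (hr : IsWeight r)
    {Γ : Matrix (Fin q) (Fin q) ℂ} (hΓ : IsSchurComplement (complexLap d r) Γ) :
    Γ *ᵥ 1 = 0 := by
  refine hΓ.mulVec_eq hd hr (e := 1) ?_
  have : (Sum.elim (1 : Fin q → ℂ) (1 : Fin m → ℂ)) = 1 := by ext (i | i) <;> rfl
  rw [this, complexLap_mulVec_one]
  ext (i | i) <;> rfl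

/-- An eigenvector of `Γ` for an imaginary eigenvalue extends to a potential that dissipates
nothing, and the imaginary part of the eigenvalue is seen by `R` alone. -/
theorem exists_of_schur_mulVec_eq_smul (hd : IsWeight d) (hr : IsWeight r)
    {Γ : Matrix (Fin q) (Fin q) ℂ} (hΓ : IsSchurComplement (complexLap d r) Γ) {v : Fin q → ℂ}
    {μ : ℂ} (hμ : μ.re = 0) (h : Γ *ᵥ v = μ • v) :
    ∃ e : Fin m → ℂ, (lap d).map Complex.ofReal *ᵥ Sum.elim v e = 0 ∧
      (lap r).map Complex.ofReal *ᵥ Sum.elim v e = (μ.im : ℂ) • Sum.elim v 0 := by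
  obtain ⟨e, he⟩ := hΓ.exists_mulVec v
  have h1 : (star (Sum.elim v e) ⬝ᵥ complexLap d r *ᵥ Sum.elim v e).re = 0 := by
    have : star (Sum.elim v e) ⬝ᵥ complexLap d r *ᵥ Sum.elim v e = μ * (star v ⬝ᵥ v) := by
      rw [he, h]
      simp [dotProduct, Finset.mul_sum, mul_left_comm]
    rw [this, Complex.mul_re, hμ, im_star_dotProduct_self]
    simp
  rw [re_star_dotProduct_complexLap hr] at h1
  have h2 := mulVec_eq_zero_of_re_eq_zero hd.posSemidef_lap h1
  refine ⟨e, h2, ?_⟩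
  rw [complexLap_mulVec, h2, zero_add, h] at he
  have h3 : μ = Complex.I * μ.im := by apply Complex.ext <;> simp [hμ]
  have h4 : (Sum.elim (μ • v) 0 : Fin q ⊕ Fin m → ℂ) =
      Complex.I • ((μ.im : ℂ) • (Sum.elim v 0 : Fin q ⊕ Fin m → ℂ)) := by
    rw [smul_smul, ← h3]
    ext (i | i) <;> simp
  rw [h4] at he
  exact smul_right_injective _ Complex.I_ne_zero he

end Schur

/-! ### Imaginary eigenvalues of the Schur complement -/

/-- A sorted list of nonnegative reals containing `0` has a positive second entry iff it contains
`0` only once. -/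
theorem count_zero_eq_one_iff {l : List ℝ} (hl : l.Pairwise (· ≤ ·))
    (hnn : ∀ a ∈ l, 0 ≤ a) (h0 : (0 : ℝ) ∈ l) (h1 : 1 < l.length) :
    l.count 0 = 1 ↔ (0 : ℝ) < l[1] := by
  match l, hl, hnn, h0, h1 with
  | a :: b :: l, hl, hnn, h0, _ =>
    have ha : a = 0 := by
      rcases List.mem_cons.1 h0 with h | h
      · exact h.symm
      · exact le_antisymm (List.rel_of_pairwise_cons hl h) (hnn a (by simp))
    subst ha
    have hb : 0 ≤ b := hnn b (by simp)
    have hlb : ∀ {c}, c ∈ l → b ≤ c := fun hc => List.rel_of_pairwise_cons (List.Pairwise.of_cons hl) hc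
    simp only [List.getElem_cons_succ, List.getElem_cons_zero, List.count_cons_self,
      Nat.add_eq_right, List.count_eq_zero, List.mem_cons, not_or]
    constructor
    · rintro ⟨hne, -⟩
      exact lt_of_le_of_ne hb hne
    · intro hpos
      exact ⟨hpos.ne, fun hmem => absurd (hlb hmem) (not_le.2 hpos)⟩

theorem numImagEig_eq_count {q : ℕ} (X : Matrix (Fin q) (Fin q) ℂ) :
    numImagEig X = (eigReList X).count 0 := by
  rw [← Multiset.coe_count, eigReList, Multiset.sort_eq, Multiset.count_map, numImagEig]
  simp only [eq_comm]

section Spectrum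

variable {q : ℕ} {Γ : Matrix (Fin q) (Fin q) ℂ}

theorem mem_roots_charpoly_iff {μ : ℂ} :
    μ ∈ Γ.charpoly.roots ↔ ∃ v, v ≠ 0 ∧ Γ *ᵥ v = μ • v := by
  rw [Polynomial.mem_roots Γ.charpoly_monic.ne_zero, ← charpoly_mulVecLin,
    ← Module.End.hasEigenvalue_iff_isRoot_charpoly]
  constructor
  · intro h
    obtain ⟨v, hv⟩ := h.exists_hasEigenvector
    exact ⟨v, hv.2, hv.apply_eq_smul⟩
  · rintro ⟨v, hv, h⟩
    exact Module.End.hasEigenvalue_of_hasEigenvector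
      ⟨Module.End.mem_eigenspace_iff.2 h, hv⟩

theorem re_nonneg_of_mulVec_eq_smul (hre : ∀ v, 0 ≤ (star v ⬝ᵥ Γ *ᵥ v).re) {v : Fin q → ℂ} {μ : ℂ}
    (hv : v ≠ 0) (h : Γ *ᵥ v = μ • v) : 0 ≤ μ.re := by
  have h1 := hre v
  rw [h, dotProduct_smul, smul_eq_mul, Complex.mul_re, im_star_dotProduct_self, mul_zero,
    sub_zero] at h1
  exact nonneg_of_mul_nonneg_left h1 (re_star_dotProduct_self_pos hv)

/-- Eigenvalues on the boundary of the half-plane that contains the numerical range are semisimple.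
-/
theorem maxGenEigenspace_eq_eigenspace (hre : ∀ v, 0 ≤ (star v ⬝ᵥ Γ *ᵥ v).re) {μ : ℂ}
    (hμ : μ.re = 0) :
    Module.End.maxGenEigenspace Γ.mulVecLin μ = Module.End.eigenspace Γ.mulVecLin μ := by
  refine le_antisymm (fun v hv => ?_) ?_
  · obtain ⟨k, hk⟩ := (Module.End.mem_maxGenEigenspace _ _ _).1 hv
    have h1 := eq_zero_of_pow_apply_eq_zero (g := Γ.mulVecLin - μ • 1) (fun v hv => ?_) k v hk
    · rw [Module.End.mem_eigenspace_iff]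
      simpa [sub_eq_zero] using h1
    · set w := (Γ.mulVecLin - μ • 1) v with hw
      have hΓv : Γ *ᵥ v = μ • v + w := by simp [hw]
      have hΓw : Γ *ᵥ w = μ • w := by simpa [sub_eq_zero] using hv
      -- `-Γ` is dissipative and has the Jordan chain `v`, `-w` for the eigenvalue `-μ`
      have : -w = 0 := eq_zero_of_dissipative_jordan (v := v) (μ := -μ) (by simpa using hμ)
        fun c => ?_
      · simpa using this
      have h2 := hre (v + (c : ℂ) • (-w))
      rw [mulVec_add, mulVec_smul, mulVec_neg, hΓv, hΓw] at h2
      have h3 : -μ • (v + (c : ℂ) • -w) + -w = -(μ • v + w + (c : ℂ) • -(μ • w)) := by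
        simp only [smul_add, smul_neg, neg_smul, smul_comm μ]
        abel
      rw [h3, dotProduct_neg, Complex.neg_re]
      linarith
  · intro v hv
    exact (Module.End.mem_maxGenEigenspace _ _ _).2
      ⟨1, by simpa [sub_eq_zero] using Module.End.mem_eigenspace_iff.1 hv⟩

/-- On the imaginary axis the algebraic multiplicity is the geometric one. -/
theorem count_roots_charpoly (hre : ∀ v, 0 ≤ (star v ⬝ᵥ Γ *ᵥ v).re) {μ : ℂ} (hμ : μ.re = 0) :
    Γ.charpoly.roots.count μ = Module.finrank ℂ (Module.End.eigenspace Γ.mulVecLin μ) := by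
  rw [← maxGenEigenspace_eq_eigenspace hre hμ, LinearMap.finrank_maxGenEigenspace_eq,
    charpoly_mulVecLin, Polynomial.count_roots]

/-- The multiplicity condition on `Γ` in terms of eigenvectors: those for imaginary eigenvalues are
constant. This includes that `0` is the only imaginary eigenvalue, since `Γ` kills constants. -/
theorem numImagEig_eq_one_iff [NeZero q] (hre : ∀ v, 0 ≤ (star v ⬝ᵥ Γ *ᵥ v).re)
    (hone : Γ *ᵥ 1 = 0) :
    numImagEig Γ = 1 ↔ ∀ (μ : ℂ) (v : Fin q → ℂ), μ.re = 0 → Γ *ᵥ v = μ • v →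
      ∃ c : ℂ, v = c • 1 := by
  have hmem : (1 : Fin q → ℂ) ∈ Module.End.eigenspace Γ.mulVecLin 0 := by
    rw [Module.End.mem_eigenspace_iff, zero_smul]; exact hone
  have h0 : (0 : ℂ) ∈ Γ.charpoly.roots.filter (fun z => z.re = 0) :=
    Multiset.mem_filter.2 ⟨mem_roots_charpoly_iff.2 ⟨1, one_ne_zero, by rw [hone, zero_smul]⟩, rfl⟩
  constructor
  · intro h μ v hμ hv
    by_cases hv0 : v = 0
    · exact ⟨0, by simp [hv0]⟩
    obtain ⟨a, ha⟩ := Multiset.card_eq_one.1 h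
    have h0a : (0 : ℂ) = a := by simpa [ha] using h0
    have hμa : μ ∈ Γ.charpoly.roots.filter (fun z => z.re = 0) :=
      Multiset.mem_filter.2 ⟨mem_roots_charpoly_iff.2 ⟨v, hv0, hv⟩, hμ⟩
    have hμ0 : μ = 0 := by rw [h0a]; simpa [ha] using hμa
    subst hμ0
    have hc := count_roots_charpoly hre (μ := 0) rfl
    have hcount : Γ.charpoly.roots.count 0 = 1 := by
      rw [← Multiset.count_filter_of_pos (p := fun z : ℂ => z.re = 0) rfl, ha, ← h0a]
      simp
    rw [hcount] at hc
    obtain ⟨c, hc⟩ := (finrank_eq_one_iff_of_nonzero' (⟨1, hmem⟩ : Module.End.eigenspace _ _)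
      (fun h => one_ne_zero (congrArg Subtype.val h))).1 hc.symm
        ⟨v, Module.End.mem_eigenspace_iff.2 hv⟩
    exact ⟨c, (congrArg Subtype.val hc).symm⟩
  · intro h
    have hall : ∀ μ ∈ Γ.charpoly.roots.filter (fun z => z.re = 0), μ = 0 := by
      intro μ hμ
      obtain ⟨hμ1, hμ2⟩ := Multiset.mem_filter.1 hμ
      obtain ⟨v, hv0, hv⟩ := mem_roots_charpoly_iff.1 hμ1
      obtain ⟨c, rfl⟩ := h μ v hμ2 hv
      rw [mulVec_smul, hone, smul_zero] at hv
      exact (smul_eq_zero.1 hv.symm).resolve_right hv0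
    have hspan : Module.End.eigenspace Γ.mulVecLin 0 = Submodule.span ℂ {1} := by
      refine le_antisymm (fun v hv => ?_) ?_
      · obtain ⟨c, rfl⟩ := h 0 v rfl (Module.End.mem_eigenspace_iff.1 hv)
        exact Submodule.smul_mem _ _ (Submodule.mem_span_singleton_self _)
      · rwa [Submodule.span_singleton_le_iff_mem]
    rw [numImagEig, ← Multiset.count_eq_card.2 fun μ hμ => (hall μ hμ).symm,
      Multiset.count_filter_of_pos (p := fun z : ℂ => z.re = 0) rfl, count_roots_charpoly hre rfl,
      hspan, finrank_span_singleton one_ne_zero]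

theorem reEig_one_pos_iff [NeZero q] (hre : ∀ v, 0 ≤ (star v ⬝ᵥ Γ *ᵥ v).re)
    (hone : Γ *ᵥ 1 = 0) (hq : 1 < q) : 0 < reEig Γ ⟨1, hq⟩ ↔ numImagEig Γ = 1 := by
  rw [numImagEig_eq_count, count_zero_eq_one_iff (l := eigReList Γ)
    (Multiset.pairwise_sort _ _) ?_ ?_
    (by rwa [length_eigReList])]
  · rfl
  · intro a ha
    rw [eigReList, Multiset.mem_sort, Multiset.mem_map] at ha
    obtain ⟨μ, hμ, rfl⟩ := ha
    obtain ⟨v, hv0, hv⟩ := mem_roots_charpoly_iff.1 hμ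
    exact re_nonneg_of_mulVec_eq_smul hre hv0 hv
  · rw [eigReList, Multiset.mem_sort, Multiset.mem_map]
    exact ⟨0, mem_roots_charpoly_iff.2 ⟨1, one_ne_zero, by rw [hone, zero_smul]⟩, rfl⟩

end Spectrum

/-! ### Undamped motions of the array -/

theorem re_map_mulVec {ι κ : Type*} [Fintype κ] (A : Matrix ι κ ℝ) (v : κ → ℂ) :
    (fun i => ((A.map Complex.ofReal *ᵥ v) i).re) = A *ᵥ fun k => (v k).re := by
  ext i
  simp [mulVec, dotProduct]

theorem im_map_mulVec {ι κ : Type*} [Fintype κ] (A : Matrix ι κ ℝ) (v : κ → ℂ) :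
    (fun i => ((A.map Complex.ofReal *ᵥ v) i).im) = A *ᵥ fun k => (v k).im := by
  ext i
  simp [mulVec, dotProduct]

/-- A natural frequency and mode of the undamped oscillator `M x'' + K x = 0`. -/
theorem exists_mulVec_eq_sq_smul {n : ℕ} (hn : 0 < n) {M K : Matrix (Fin n) (Fin n) ℝ}
    (hM : M.PosDef) (hK : K.PosDef) :
    ∃ (ω : ℝ) (e : Fin n → ℝ), 0 < ω ∧ e ≠ 0 ∧ K *ᵥ e = ω ^ 2 • M *ᵥ e := by
  obtain ⟨Q, hQ⟩ := exists_eq_transpose_mul_self hM.posSemidef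
  have hdet : IsUnit Q.det := isUnit_det_of_posDef hM hQ
  have hQQ : Q⁻¹ * Q = 1 := nonsing_inv_mul _ hdet
  have hS : (Q⁻¹ᵀ * K * Q⁻¹).IsHermitian := by
    have := hK.isHermitian
    rw [IsHermitian, conjTranspose_eq_transpose_of_trivial] at this ⊢
    simp only [transpose_mul, transpose_transpose, this, Matrix.mul_assoc]
  let i₀ : Fin n := ⟨0, hn⟩
  let f : Fin n → ℝ := hS.eigenvectorBasis i₀
  have hf : f ≠ 0 := by
    intro h
    exact hS.eigenvectorBasis.orthonormal.ne_zero i₀ (PiLp.ext fun j => congrFun h j)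
  set θ := hS.eigenvalues i₀
  have hSf : (Q⁻¹ᵀ * K * Q⁻¹) *ᵥ f = θ • f := hS.mulVec_eigenvectorBasis i₀
  have he : Q⁻¹ *ᵥ f ≠ 0 := by
    intro h
    apply hf
    have := congrArg (Q *ᵥ ·) h
    simpa [mulVec_mulVec, mul_nonsing_inv _ hdet] using this
  have hKe : K *ᵥ (Q⁻¹ *ᵥ f) = θ • M *ᵥ (Q⁻¹ *ᵥ f) := by
    have h1 := congrArg (Qᵀ *ᵥ ·) hSf
    simp only [mulVec_mulVec, mulVec_smul] at h1
    have h2 : Qᵀ * (Q⁻¹ᵀ * K * Q⁻¹) = K * Q⁻¹ := by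
      rw [← Matrix.mul_assoc, ← Matrix.mul_assoc, ← transpose_mul, hQQ, transpose_one,
        Matrix.one_mul]
    rw [h2] at h1
    rw [mulVec_mulVec, h1, mulVec_mulVec, hQ, Matrix.mul_assoc, mul_nonsing_inv _ hdet,
      Matrix.mul_one]
  have hθ : 0 < θ := by
    have h1 := hK.dotProduct_mulVec_pos he
    have h2 := hM.dotProduct_mulVec_pos he
    rw [hKe, dotProduct_smul, smul_eq_mul] at h1
    exact pos_of_mul_pos_left h1 h2.le
  exact ⟨√θ, _, Real.sqrt_pos.2 hθ, he, by rw [Real.sq_sqrt hθ.le, hKe]⟩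

theorem mulVec_vec_single {n : ℕ} (B : Matrix (Fin n) (Fin 1) ℝ) (c : ℝ) (v : Fin 1 → ℝ) :
    B *ᵥ ![c * v 0] = c • B *ᵥ v := by
  rw [← mulVec_smul]
  congr 1
  ext i
  fin_cases i
  rfl

section NecessaryCondition

variable {q m : ℕ} {d r : Fin q ⊕ Fin m → Fin q ⊕ Fin m → ℝ} {n : ℕ}
  {M K : Matrix (Fin n) (Fin n) ℝ} {B : Matrix (Fin n) (Fin 1) ℝ}

/-- If a potential `w` is invisible to `D` and is mapped by `R` to a multiple `l` of its boundary
part, then the oscillators can move as `x i = w i cos (ω t) e`: the network acts on each of them as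
the spring `l B Bᵀ`, and `e` is a mode of `M x'' + (K + l B Bᵀ) x = 0`. Such a motion does not
decay, so synchronization forces `w` to be constant on the boundary. -/
theorem Synchronizes.eq_of_lap_mulVec (hr : IsWeight r) (hosc : IsOscillator M K B)
    (hsync : Synchronizes d r M K B) {w : Fin q ⊕ Fin m → ℝ} {l : ℝ} (hd0 : lap d *ᵥ w = 0)
    (hr0 : lap r *ᵥ w = l • Sum.elim (fun i => w (Sum.inl i)) 0) (i j : Fin q) :
    w (Sum.inl i) = w (Sum.inl j) := by
  by_contra hij
  -- `l` is nonnegative because `R` is positive semidefinite and `w` is nonzero on the boundary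
  have hl : 0 ≤ l := by
    have h1 := hr.posSemidef_lap.dotProduct_mulVec_nonneg w
    have h2 : star w ⬝ᵥ lap r *ᵥ w = l * ∑ i, w (Sum.inl i) ^ 2 := by
      rw [hr0]
      simp [dotProduct, Finset.mul_sum, pow_two, mul_left_comm]
    rw [h2] at h1
    refine nonneg_of_mul_nonneg_left h1 ?_
    by_contra hcon
    have h3 : ∑ i, w (Sum.inl i) ^ 2 = 0 :=
      le_antisymm (not_lt.1 hcon) (Finset.sum_nonneg fun i _ => sq_nonneg _)
    rw [Finset.sum_eq_zero_iff_of_nonneg fun i _ => sq_nonneg _] at h3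
    apply hij
    rw [pow_eq_zero_iff two_ne_zero |>.1 (h3 i (Finset.mem_univ _)),
      pow_eq_zero_iff two_ne_zero |>.1 (h3 j (Finset.mem_univ _))]
  have hK' : (K + l • (B * Bᵀ)).PosDef := by
    refine hosc.posDef_K.add_posSemidef (PosSemidef.smul ?_ hl)
    have := posSemidef_self_mul_conjTranspose B
    rwa [conjTranspose_eq_transpose_of_trivial] at this
  obtain ⟨ω, e, hω, he, hKe⟩ := exists_mulVec_eq_sq_smul hosc.pos hosc.posDef_M hK'
  have hKe' : K *ᵥ e = ω ^ 2 • M *ᵥ e - l • B *ᵥ (Bᵀ *ᵥ e) := by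
    rw [← hKe, add_mulVec, smul_mulVec, mulVec_mulVec]
    abel
  set b := (Bᵀ *ᵥ e) 0 with hb
  have hcos : ∀ t : ℝ, HasDerivAt (fun t => Real.cos (ω * t)) (-(ω * Real.sin (ω * t))) t := by
    intro t
    have := (Real.hasDerivAt_cos (ω * t)).comp t ((hasDerivAt_id t).const_mul ω)
    exact this.congr_deriv (by simp; ring)
  have hsin : ∀ t : ℝ, HasDerivAt (fun t => -(ω * Real.sin (ω * t)))
      (-(ω ^ 2 * Real.cos (ω * t))) t := by
    intro t
    have := (((Real.hasDerivAt_sin (ω * t)).comp t ((hasDerivAt_id t).const_mul ω)).const_mul ω).neg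
    exact this.congr_deriv (by simp; ring)
  have hdz : ∀ k (c : ℝ), ∑ l, d k l * (w k * (c * b) - w l * (c * b)) = 0 := by
    intro k c
    have := congrFun hd0 k
    rw [lap_mulVec] at this
    calc _ = (∑ l, d k l * (w k - w l)) * (c * b) := by
            rw [Finset.sum_mul]; exact Finset.sum_congr rfl fun _ _ => by ring
      _ = 0 := by rw [this]; simp
  have hrz : ∀ k (c : ℝ), ∑ l, r k l * (w k * (c * b) - w l * (c * b)) =
      l * (Sum.elim (fun i => w (Sum.inl i)) 0 : Fin q ⊕ Fin m → ℝ) k * (c * b) := by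
    intro k c
    have := congrFun hr0 k
    rw [lap_mulVec, Pi.smul_apply, smul_eq_mul] at this
    rw [← this, Finset.sum_mul]
    exact Finset.sum_congr rfl fun _ _ => by ring
  have hsol : IsSolution d r M K B
      (fun i t => (w (Sum.inl i) * Real.cos (ω * t)) • e)
      (fun i t => (w (Sum.inl i) * -(ω * Real.sin (ω * t))) • e)
      (fun i t => (w (Sum.inl i) * -(ω ^ 2 * Real.cos (ω * t))) • e)
      (fun i t => -(l * w (Sum.inl i) * Real.cos (ω * t)) * b)
      (fun i t => w (Sum.inl i) * (Real.cos (ω * t) * b))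
      (fun k t => w k * (Real.cos (ω * t) * b))
      (fun k t => w k * (-(ω * Real.sin (ω * t)) * b)) := by
    refine ⟨fun i t _ => ?_, fun i t _ => ?_, fun k t _ => ?_, fun i t _ => ?_, fun i t _ => ?_,
      fun i t _ => ?_, fun k t _ => ?_, fun i t _ => sub_self _⟩
    · exact (((hcos t).const_mul _).smul_const e).hasDerivWithinAt
    · exact (((hsin t).const_mul _).smul_const e).hasDerivWithinAt
    · exact (((hcos t).mul_const b).const_mul _).hasDerivWithinAt
    · rw [hb, mulVec_vec_single, mulVec_smul, mulVec_smul, hKe']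
      module
    · rw [mulVec_smul]
      ext k
      fin_cases k
      simp [hb]; ring
    · rw [hdz, hrz]
      simp; ring
    · rw [hdz, hrz]
      simp
  have hlim := hsync _ _ _ _ _ _ _ hsol i j
  -- at multiples of the period the distance `‖x i t - x j t‖` has the constant value `‖(w i - w j) e‖`
  have hseq : Tendsto (fun k : ℕ => (k : ℝ) * (2 * Real.pi / ω)) atTop atTop :=
    tendsto_natCast_atTop_atTop.atTop_mul_const (by positivity)
  have hconst := hlim.comp hseq
  have hval : ∀ k : ℕ, ω * ((k : ℝ) * (2 * Real.pi / ω)) = k * (2 * Real.pi) := fun k => by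
    field_simp
  simp only [Function.comp_def, hval, Real.cos_nat_mul_two_pi, mul_one, ← sub_smul] at hconst
  have := tendsto_nhds_unique hconst tendsto_const_nhds
  rw [eq_comm, norm_eq_zero, smul_eq_zero, sub_eq_zero] at this
  exact this.elim hij he

theorem Synchronizes.eq_smul_one (hq : 1 ≤ q) (hd : IsWeight d) (hr : IsWeight r)
    {Γ : Matrix (Fin q) (Fin q) ℂ} (hΓ : IsSchurComplement (complexLap d r) Γ)
    (hosc : IsOscillator M K B) (hsync : Synchronizes d r M K B) {μ : ℂ} {v : Fin q → ℂ}
    (hμ : μ.re = 0) (hv : Γ *ᵥ v = μ • v) : ∃ c : ℂ, v = c • 1 := by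
  obtain ⟨e, h1, h2⟩ := exists_of_schur_mulVec_eq_smul hd hr hΓ hμ hv
  have hre : ∀ i j, (v i).re = (v j).re := by
    refine hsync.eq_of_lap_mulVec hr hosc (w := fun k => (Sum.elim v e k).re) (l := μ.im) ?_ ?_
    · rw [← re_map_mulVec, h1]; ext; simp
    · rw [← re_map_mulVec, h2]; ext (k | k) <;> simp
  have him : ∀ i j, (v i).im = (v j).im := by
    refine hsync.eq_of_lap_mulVec hr hosc (w := fun k => (Sum.elim v e k).im) (l := μ.im) ?_ ?_
    · rw [← im_map_mulVec, h1]; ext; simp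
    · rw [← im_map_mulVec, h2]; ext (k | k) <;> simp
  refine ⟨v ⟨0, hq⟩, ?_⟩
  ext i
  simpa using Complex.ext (hre i ⟨0, hq⟩) (him i ⟨0, hq⟩)

end NecessaryCondition

/-! ### Energy balance and oscillating modes -/

theorem star_mulVec_dotProduct_mulVec {V : Type*} [Fintype V] {A L : Matrix V V ℝ}
    (h : A = Lᵀ * L) (v w : V → ℂ) :
    star (L.map Complex.ofReal *ᵥ v) ⬝ᵥ L.map Complex.ofReal *ᵥ w =
      star v ⬝ᵥ A.map Complex.ofReal *ᵥ w := by
  rw [h, map_ofReal_transpose_mul_self, star_mulVec, ← dotProduct_mulVec, mulVec_mulVec]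

theorem re_star_dotProduct_mulVec_comm {V : Type*} [Fintype V] {A : Matrix V V ℝ}
    (hA : A.PosSemidef) (v w : V → ℂ) :
    (star v ⬝ᵥ A.map Complex.ofReal *ᵥ w).re = (star w ⬝ᵥ A.map Complex.ofReal *ᵥ v).re := by
  classical
  obtain ⟨L, hL⟩ := exists_eq_transpose_mul_self hA
  rw [← star_mulVec_dotProduct_mulVec hL, ← star_mulVec_dotProduct_mulVec hL, ← Complex.conj_re,
    starRingEnd_apply, star_dotProduct, star_star]

theorem eq_zero_of_map_mulVec_eq_zero {ι κ : Type*} [Fintype κ] {A : Matrix ι κ ℝ}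
    (hA : ∀ v, A *ᵥ v = 0 → v = 0) {v : κ → ℂ} (hv : A.map Complex.ofReal *ᵥ v = 0) : v = 0 := by
  have h1 := hA _ ((re_map_mulVec A v).symm.trans (by rw [hv]; rfl))
  have h2 := hA _ ((im_map_mulVec A v).symm.trans (by rw [hv]; rfl))
  ext k
  exact Complex.ext (congrFun h1 k) (congrFun h2 k)

theorem eq_zero_of_rank_eq {ι : Type*} [Fintype ι] {n : ℕ} {A : Matrix ι (Fin n) ℝ}
    (hA : A.rank = n) (v : Fin n → ℝ) (hv : A *ᵥ v = 0) : v = 0 := by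
  have h1 := A.mulVecLin.finrank_range_add_finrank_ker
  rw [← Matrix.rank, hA, Module.finrank_fin_fun, Nat.add_eq_left, Submodule.finrank_eq_zero] at h1
  have : v ∈ LinearMap.ker A.mulVecLin := hv
  rwa [h1, Submodule.mem_bot] at this

/-- The equations of the array at one instant, over `ℂ`: `x`, `p`, `a` stand for the positions,
velocities and accelerations of the oscillators, `z` and `z'` for the potentials and their
derivatives, and `u` for the inputs. The condition `attach'` is the time derivative of `attach`. -/
structure IsNetworkState {q m n : ℕ} (d r : Fin q ⊕ Fin m → Fin q ⊕ Fin m → ℝ)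
    (M K : Matrix (Fin n) (Fin n) ℝ) (B : Matrix (Fin n) (Fin 1) ℝ)
    (x p a : Fin q → Fin n → ℂ) (u : Fin q → ℂ) (z z' : Fin q ⊕ Fin m → ℂ) : Prop where
  oscillator : ∀ i, M.map Complex.ofReal *ᵥ a i + K.map Complex.ofReal *ᵥ x i =
    u i • fun k => (B k 0 : ℂ)
  attach : ∀ i, z (Sum.inl i) = (fun k => (B k 0 : ℂ)) ⬝ᵥ x i
  attach' : ∀ i, z' (Sum.inl i) = (fun k => (B k 0 : ℂ)) ⬝ᵥ p i
  network : (lap d).map Complex.ofReal *ᵥ z' + (lap r).map Complex.ofReal *ᵥ z = Sum.elim (-u) 0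

section OscillatingModes

variable {q m n : ℕ} {d r : Fin q ⊕ Fin m → Fin q ⊕ Fin m → ℝ}
  {M K : Matrix (Fin n) (Fin n) ℝ} {B : Matrix (Fin n) (Fin 1) ℝ}
  {x p a : Fin q → Fin n → ℂ} {u : Fin q → ℂ} {z z' : Fin q ⊕ Fin m → ℂ}

theorem star_dotProduct_ofReal (b : Fin n → ℝ) (v : Fin n → ℂ) :
    star v ⬝ᵥ (fun k => (b k : ℂ)) = star ((fun k => (b k : ℂ)) ⬝ᵥ v) := by
  simp [dotProduct, mul_comm]

/-- The left-hand side is the rate of change of the energy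
`½ ∑ (x* K x + p* M p) + ½ z* R z` along solutions. -/
theorem IsNetworkState.power_balance (h : IsNetworkState d r M K B x p a u z z')
    (hK : K.PosSemidef) (hr : (lap r).PosSemidef) :
    (∑ i, star (x i) ⬝ᵥ K.map Complex.ofReal *ᵥ p i).re +
      (∑ i, star (p i) ⬝ᵥ M.map Complex.ofReal *ᵥ a i).re +
      (star z ⬝ᵥ (lap r).map Complex.ofReal *ᵥ z').re =
    -(star z' ⬝ᵥ (lap d).map Complex.ofReal *ᵥ z').re := by
  have h1 : (∑ i, star (x i) ⬝ᵥ K.map Complex.ofReal *ᵥ p i).re =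
      (∑ i, star (p i) ⬝ᵥ K.map Complex.ofReal *ᵥ x i).re := by
    simp only [Complex.re_sum]
    exact Finset.sum_congr rfl fun i _ => re_star_dotProduct_mulVec_comm hK _ _
  have h2 : ∑ i, star (p i) ⬝ᵥ M.map Complex.ofReal *ᵥ a i +
      ∑ i, star (p i) ⬝ᵥ K.map Complex.ofReal *ᵥ x i = ∑ i, u i * star (z' (Sum.inl i)) := by
    rw [← Finset.sum_add_distrib]
    refine Finset.sum_congr rfl fun i _ => ?_
    rw [← dotProduct_add, h.oscillator, dotProduct_smul, star_dotProduct_ofReal, ← h.attach',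
      smul_eq_mul]
  have h3 : star z' ⬝ᵥ (lap d).map Complex.ofReal *ᵥ z' +
      star z' ⬝ᵥ (lap r).map Complex.ofReal *ᵥ z = -∑ i, u i * star (z' (Sum.inl i)) := by
    rw [← dotProduct_add, h.network]
    simp [dotProduct, mul_comm]
  have h4 := congrArg Complex.re h2
  have h5 := congrArg Complex.re h3
  simp only [Complex.add_re, Complex.neg_re] at h4 h5
  rw [h1, re_star_dotProduct_mulVec_comm hr z z']
  linarith

/-- At equilibrium `∑ x* K x = -z* R z`, so only the rest position is possible. -/
theorem IsNetworkState.static_eq_zero (h : IsNetworkState d r M K B x 0 0 u z z')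
    (hK : K.PosDef) (hr : (lap r).PosSemidef)
    (hd0 : (lap d).map Complex.ofReal *ᵥ z' = 0) (i : Fin q) : x i = 0 := by
  have h1 : ∑ i, star (x i) ⬝ᵥ K.map Complex.ofReal *ᵥ x i = ∑ i, u i * star (z (Sum.inl i)) := by
    refine Finset.sum_congr rfl fun i _ => ?_
    have := h.oscillator i
    rw [Pi.zero_apply, mulVec_zero, zero_add] at this
    rw [this, dotProduct_smul, star_dotProduct_ofReal, ← h.attach, smul_eq_mul]
  have h2 : star z ⬝ᵥ (lap r).map Complex.ofReal *ᵥ z = -∑ i, u i * star (z (Sum.inl i)) := by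
    have := h.network
    rw [hd0, zero_add] at this
    rw [this]
    simp [dotProduct, mul_comm]
  have h3 := re_star_dotProduct_mulVec_nonneg hr z
  rw [h2, Complex.neg_re, ← h1, Complex.re_sum] at h3
  have hnn : ∀ i ∈ Finset.univ, 0 ≤ (star (x i) ⬝ᵥ K.map Complex.ofReal *ᵥ x i).re :=
    fun i _ => re_star_dotProduct_mulVec_nonneg hK.posSemidef _
  have h4 := (Finset.sum_eq_zero_iff_of_nonneg hnn).1
    (le_antisymm (by linarith) (Finset.sum_nonneg hnn)) i (Finset.mem_univ i)
  refine eq_zero_of_map_mulVec_eq_zero (fun v hv => ?_)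
    (mulVec_eq_zero_of_re_eq_zero hK.posSemidef h4)
  by_contra hv0
  have := hK.dotProduct_mulVec_pos hv0
  simp [hv] at this

/-- In a purely oscillating mode (`p = μ x`, `a = μ p`, `Re μ = 0`, no dissipation) the oscillators
move in unison, provided that the imaginary eigenvectors of `Γ` are constant. With `H = K - ω² M`
and `y i = bᵀ x i` one has `H x i = u i b` and `Γ y = -j u`. Symmetry of `H` makes `u` a real
multiple of `y`, so that `y` is an eigenvector of `Γ` for an imaginary eigenvalue; hence `y` is
constant and `u = 0`, and observability gives `x i = x j`. -/
theorem IsNetworkState.eq_of_imaginary (h : IsNetworkState d r M K B x p a u z z')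
    (hd : IsWeight d) (hr : IsWeight r) {Γ : Matrix (Fin q) (Fin q) ℂ}
    (hΓ : IsSchurComplement (complexLap d r) Γ) (hosc : IsOscillator M K B)
    (hconst : ∀ (μ : ℂ) (v : Fin q → ℂ), μ.re = 0 → Γ *ᵥ v = μ • v → ∃ c : ℂ, v = c • 1)
    {μ : ℂ} (hμ : μ.re = 0) (hp : p = μ • x) (ha : a = μ • p)
    (hz : (lap r).map Complex.ofReal *ᵥ z' = μ • (lap r).map Complex.ofReal *ᵥ z)
    (hd0 : (lap d).map Complex.ofReal *ᵥ z' = 0) (i j : Fin q) : x i = x j := by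
  by_cases hμ0 : μ = 0
  · subst hμ0
    rw [zero_smul] at hp ha
    subst hp ha
    rw [h.static_eq_zero hosc.posDef_K hr.posSemidef_lap hd0 i,
      h.static_eq_zero hosc.posDef_K hr.posSemidef_lap hd0 j]
  have hω : 0 < |μ.im| := abs_pos.2 fun him => hμ0 (Complex.ext hμ him)
  set ω := |μ.im| with hωdef
  have hμω : μ ^ 2 = -((ω ^ 2 : ℝ) : ℂ) := by
    rw [hωdef, sq_abs]
    apply Complex.ext <;> simp [pow_two, hμ]
  set b : Fin n → ℂ := fun k => (B k 0 : ℂ) with hb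
  set H := (K - ω ^ 2 • M).map Complex.ofReal with hH
  have hHeq : H = K.map Complex.ofReal - ((ω ^ 2 : ℝ) : ℂ) • M.map Complex.ofReal := by
    rw [hH]
    ext k l
    simp
  have hHx : ∀ i, H *ᵥ x i = u i • b := by
    intro i
    rw [← h.oscillator i, ha, hp, hHeq, Pi.smul_apply, Pi.smul_apply, smul_smul, ← pow_two, hμω,
      sub_mulVec, smul_mulVec, mulVec_smul, neg_smul]
    abel
  set y : Fin q → ℂ := fun i => z (Sum.inl i) with hy
  have hyb : ∀ i, b ⬝ᵥ x i = y i := fun i => (h.attach i).symm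
  have hΓy : Γ *ᵥ y = -(Complex.I • u) := by
    have h1 : (lap r).map Complex.ofReal *ᵥ z = Sum.elim (-u) 0 := by
      have := h.network
      rwa [hd0, zero_add] at this
    -- `z'` is a potential with boundary part `μ y` and boundary current `-j μ u`
    have h2 : z' = Sum.elim (μ • y) (fun k => z' (Sum.inr k)) := by
      ext (k | k)
      · rw [Sum.elim_inl, h.attach' k, hp, Pi.smul_apply, dotProduct_smul, Pi.smul_apply, ← hb,
          hyb]
      · rfl
    have h3 : complexLap d r *ᵥ Sum.elim (μ • y) (fun k => z' (Sum.inr k)) =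
        Sum.elim (μ • -(Complex.I • u)) 0 := by
      rw [← h2, complexLap_mulVec, hd0, zero_add, hz, h1]
      ext (k | k)
      · simp; ring
      · simp
    have h4 := hΓ.mulVec_eq hd hr h3
    rw [mulVec_smul] at h4
    exact smul_right_injective _ hμ0 h4
  have hHsymm : Hᵀ = H := by
    have hKs := hosc.posDef_K.isHermitian
    have hMs := hosc.posDef_M.isHermitian
    rw [IsHermitian, conjTranspose_eq_transpose_of_trivial] at hKs hMs
    rw [hH, ← transpose_map, transpose_sub, transpose_smul, hKs, hMs]
  -- reciprocity: evaluate `x iᵀ H x j` in two ways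
  have hsym : ∀ i j, y i * u j = y j * u i := by
    intro i j
    have h1 : x i ⬝ᵥ H *ᵥ x j = x j ⬝ᵥ H *ᵥ x i := by
      rw [dotProduct_mulVec, ← mulVec_transpose, hHsymm, dotProduct_comm]
    rw [hHx, hHx, dotProduct_smul, dotProduct_smul, dotProduct_comm, hyb, dotProduct_comm, hyb,
      smul_eq_mul, smul_eq_mul] at h1
    rw [mul_comm, h1, mul_comm]
  -- `x i* H x i` is real
  have hreal : ∀ i, (star (y i) * u i).im = 0 := by
    intro i
    have h1 : star (x i) ⬝ᵥ H *ᵥ x i = star (y i) * u i := by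
      rw [hHx, dotProduct_smul, hb, star_dotProduct_ofReal, ← hb, hyb, smul_eq_mul, mul_comm]
    rw [← h1, hHeq, sub_mulVec, smul_mulVec, dotProduct_sub, dotProduct_smul, Complex.sub_im,
      smul_eq_mul, Complex.mul_im, im_star_dotProduct_mulVec hosc.posDef_K.posSemidef,
      im_star_dotProduct_mulVec hosc.posDef_M.posSemidef, Complex.ofReal_im]
    simp
  have hyc : ∃ c : ℂ, y = c • 1 := by
    by_cases hy0 : y = 0
    · exact ⟨0, by simp [hy0]⟩
    obtain ⟨k, hk⟩ : ∃ k, y k ≠ 0 := Function.ne_iff.1 hy0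
    have hu : u = (u k / y k) • y := by
      ext l
      have := hsym k l
      rw [Pi.smul_apply, smul_eq_mul]
      field_simp
      linear_combination this
    have hc : (u k / y k).im = 0 := by
      have h1 : star (y k) * u k = ((Complex.normSq (y k) : ℝ) : ℂ) * (u k / y k) := by
        rw [Complex.normSq_eq_conj_mul_self, starRingEnd_apply]
        field_simp
      have h2 := hreal k
      rw [h1, Complex.im_ofReal_mul] at h2
      exact (mul_eq_zero.1 h2).resolve_left (Complex.normSq_pos.2 hk).ne'
    refine hconst (-(Complex.I * (u k / y k))) y ?_ ?_
    · simp [Complex.mul_re, hc]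
    · rw [hΓy]
      nth_rewrite 1 [hu]
      rw [smul_smul, neg_smul]
  obtain ⟨c, hc⟩ := hyc
  have hu0 : u = 0 := by
    have h1 : Γ *ᵥ y = 0 := by rw [hc, mulVec_smul, schur_mulVec_one hd hr hΓ, smul_zero]
    rw [hΓy, neg_eq_zero] at h1
    exact (smul_eq_zero.1 h1).resolve_left Complex.I_ne_zero
  have hker : (fromRows (K - ω ^ 2 • M) Bᵀ).map Complex.ofReal *ᵥ (x i - x j) = 0 := by
    have h1 : (fromRows (K - ω ^ 2 • M) Bᵀ).map Complex.ofReal =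
        fromRows H (Bᵀ.map Complex.ofReal) := by
      ext (k | k) l <;> rfl
    rw [h1, fromRows_mulVec, mulVec_sub, hHx, hHx, hu0]
    have h2 : Bᵀ.map Complex.ofReal *ᵥ (x i - x j) = 0 := by
      ext k
      fin_cases k
      change b ⬝ᵥ (x i - x j) = 0
      rw [dotProduct_sub, hyb, hyb, hc]
      simp
    rw [h2]
    ext (k | k) <;> simp
  exact sub_eq_zero.1 (eq_zero_of_map_mulVec_eq_zero
    (eq_zero_of_rank_eq (hosc.observable ω hω)) hker)

end OscillatingModes

/-! ### Convergence of solutions -/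

section SufficientCondition

variable {q m n : ℕ}

/-- The variables `(x, p, a, u, z, z')` of `IsNetworkState`. -/
abbrev NetworkVars (q m n : ℕ) : Type :=
  (Fin q → Fin n → ℂ) × (Fin q → Fin n → ℂ) × (Fin q → Fin n → ℂ) × (Fin q → ℂ) ×
    (Fin q ⊕ Fin m → ℂ) × (Fin q ⊕ Fin m → ℂ)

/-- The linear space of solutions of the pointwise equations `IsNetworkState`. -/
def networkStates (d r : Fin q ⊕ Fin m → Fin q ⊕ Fin m → ℝ)
    (M K : Matrix (Fin n) (Fin n) ℝ) (B : Matrix (Fin n) (Fin 1) ℝ) :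
    Submodule ℂ (NetworkVars q m n) where
  carrier := {s | IsNetworkState d r M K B s.1 s.2.1 s.2.2.1 s.2.2.2.1 s.2.2.2.2.1 s.2.2.2.2.2}
  zero_mem' := by
    refine ⟨fun i => ?_, fun i => ?_, fun i => ?_, ?_⟩
    · simp
    · simp
    · simp
    · ext (k | k) <;> simp
  add_mem' := by
    rintro s s' hs hs'
    refine ⟨fun i => ?_, fun i => ?_, fun i => ?_, ?_⟩
    · have h1 := hs.oscillator i
      have h2 := hs'.oscillator i
      simp only [Prod.fst_add, Prod.snd_add, Pi.add_apply, mulVec_add, add_smul, ← h1, ← h2]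
      abel
    · simp [hs.attach i, hs'.attach i, dotProduct_add]
    · simp [hs.attach' i, hs'.attach' i, dotProduct_add]
    · have h1 := hs.network
      have h2 := hs'.network
      simp only [Prod.fst_add, Prod.snd_add, mulVec_add]
      rw [add_add_add_comm, h1, h2]
      ext (k | k) <;> simp [add_comm]
  smul_mem' := by
    rintro c s hs
    refine ⟨fun i => ?_, fun i => ?_, fun i => ?_, ?_⟩
    · have h1 := hs.oscillator i
      simp only [Prod.smul_fst, Prod.smul_snd, Pi.smul_apply, mulVec_smul, ← smul_add, h1,
        smul_smul, smul_eq_mul]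
    · simp [hs.attach i, dotProduct_smul]
    · simp [hs.attach' i, dotProduct_smul]
    · have h1 := hs.network
      simp only [Prod.smul_fst, Prod.smul_snd, mulVec_smul, ← smul_add, h1]
      ext (k | k) <;> simp

/-- The energy coordinates `(Q x, N p, L z)`. For `K = Qᵀ Q`, `M = Nᵀ N`, `lap r = Lᵀ L` their
squared norm is twice the energy stored in the oscillators and in the edges of the network. They
see `z` only through `lap r`, which is why they need not determine the network state. -/
noncomputable def energyVec (Q N : Matrix (Fin n) (Fin n) ℝ)
    (L : Matrix (Fin q ⊕ Fin m) (Fin q ⊕ Fin m) ℝ) :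
    ((Fin q → Fin n → ℂ) × (Fin q → Fin n → ℂ) × (Fin q ⊕ Fin m → ℂ)) →ₗ[ℂ]
      ((Fin q × Fin n) ⊕ (Fin q × Fin n) ⊕ (Fin q ⊕ Fin m) → ℂ) where
  toFun s := Sum.elim (fun k => (Q.map Complex.ofReal *ᵥ s.1 k.1) k.2)
    (Sum.elim (fun k => (N.map Complex.ofReal *ᵥ s.2.1 k.1) k.2) (L.map Complex.ofReal *ᵥ s.2.2))
  map_add' s s' := by ext (k | k | k) <;> simp [mulVec_add]
  map_smul' c s := by ext (k | k | k) <;> simp [mulVec_smul]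

theorem star_energyVec_dotProduct {K M Q N : Matrix (Fin n) (Fin n) ℝ}
    {R L : Matrix (Fin q ⊕ Fin m) (Fin q ⊕ Fin m) ℝ} (hQ : K = Qᵀ * Q) (hN : M = Nᵀ * N)
    (hL : R = Lᵀ * L) (x p x' p' : Fin q → Fin n → ℂ) (z z' : Fin q ⊕ Fin m → ℂ) :
    star (energyVec Q N L (x, p, z)) ⬝ᵥ energyVec Q N L (x', p', z') =
      ∑ i, star (x i) ⬝ᵥ K.map Complex.ofReal *ᵥ x' i +
        ∑ i, star (p i) ⬝ᵥ M.map Complex.ofReal *ᵥ p' i +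
        star z ⬝ᵥ R.map Complex.ofReal *ᵥ z' := by
  simp only [← star_mulVec_dotProduct_mulVec hQ, ← star_mulVec_dotProduct_mulVec hN,
    ← star_mulVec_dotProduct_mulVec hL]
  rw [dotProduct, Fintype.sum_sum_type, Fintype.sum_sum_type, Fintype.sum_prod_type,
    Fintype.sum_prod_type, ← add_assoc]
  rfl

variable {d r : Fin q ⊕ Fin m → Fin q ⊕ Fin m → ℝ}
  {M K : Matrix (Fin n) (Fin n) ℝ} {B : Matrix (Fin n) (Fin 1) ℝ}

theorem ofReal_map_mulVec {ι κ : Type*} [Fintype κ] (A : Matrix ι κ ℝ) (v : κ → ℝ) (i : ι) :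
    (A.map Complex.ofReal *ᵥ fun k => (v k : ℂ)) i = ((A *ᵥ v) i : ℝ) := by
  simp [mulVec, dotProduct]

theorem IsSolution.isNetworkState
    {x x' x'' : Fin q → ℝ → Fin n → ℝ} {u y : Fin q → ℝ → ℝ} {z z' : Fin q ⊕ Fin m → ℝ → ℝ}
    (h : IsSolution d r M K B x x' x'' u y z z') {t : ℝ} (ht : 0 ≤ t) :
    IsNetworkState d r M K B (fun i k => x i t k) (fun i k => x' i t k) (fun i k => x'' i t k)
      (fun i => u i t) (fun k => z k t) (fun k => z' k t) := by
  have hatt : ∀ i, ∀ t, 0 ≤ t → z (Sum.inl i) t = (fun k => B k 0) ⬝ᵥ x i t := by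
    intro i t ht
    rw [sub_eq_zero.1 (h.attach i t ht)]
    exact congrFun (h.output i t ht) 0
  refine ⟨fun i => ?_, fun i => ?_, fun i => ?_, ?_⟩
  · ext k
    rw [Pi.add_apply, ofReal_map_mulVec, ofReal_map_mulVec, ← Complex.ofReal_add]
    have := congrFun (h.oscillator i t ht) k
    rw [Pi.add_apply] at this
    rw [this]
    simp [mulVec, dotProduct, mul_comm]
  · have := hatt i t ht
    simp only [this]
    simp [dotProduct]
  · -- differentiating the attachment constraint
    have h1 : HasDerivWithinAt (z (Sum.inl i)) ((fun k => B k 0) ⬝ᵥ x' i t) (Set.Ici 0) t := by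
      have h2 := hasDerivWithinAt_pi.1 (h.deriv_x i t ht)
      have h3 : HasDerivWithinAt (fun t => ∑ k, B k 0 * x i t k) (∑ k, B k 0 * x' i t k)
          (Set.Ici 0) t := HasDerivWithinAt.fun_sum fun k _ => (h2 k).const_mul (B k 0)
      exact h3.congr (fun s hs => hatt i s hs) (hatt i t ht)
    have h2 := (uniqueDiffOn_Ici (0 : ℝ) t ht).eq_deriv _ (h.deriv_z (Sum.inl i) t ht) h1
    simp only [h2]
    simp [dotProduct]
  · ext (k | k)
    · rw [Pi.add_apply, ofReal_map_mulVec (lap d) (fun k => z' k t),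
        ofReal_map_mulVec (lap r) (fun k => z k t), lap_mulVec, lap_mulVec, ← Complex.ofReal_add]
      have := h.boundary k t ht
      rw [Sum.elim_inl, Pi.neg_apply, ← Complex.ofReal_neg]
      congr 1
      linarith
    · rw [Pi.add_apply, ofReal_map_mulVec (lap d) (fun k => z' k t),
        ofReal_map_mulVec (lap r) (fun k => z k t), lap_mulVec, lap_mulVec, ← Complex.ofReal_add,
        h.interior k t ht]
      simp

theorem map_mulVec_injective {Q : Matrix (Fin n) (Fin n) ℝ} (hQ : IsUnit Q.det) {v w : Fin n → ℂ}
    (h : Q.map Complex.ofReal *ᵥ v = Q.map Complex.ofReal *ᵥ w) : v = w := by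
  rw [← sub_eq_zero] at h ⊢
  rw [← mulVec_sub] at h
  refine eq_zero_of_map_mulVec_eq_zero (fun v hv => ?_) h
  exact mulVec_injective_of_isUnit ((isUnit_iff_isUnit_det Q).2 hQ) (hv.trans (mulVec_zero Q).symm)

/-- The sufficient condition: the invariance principle applied to the states in energy coordinates,
with output `x i - x j`. -/
theorem synchronizes_of_forall_eq_smul_one (hd : IsWeight d) (hr : IsWeight r)
    {Γ : Matrix (Fin q) (Fin q) ℂ} (hΓ : IsSchurComplement (complexLap d r) Γ)
    (hosc : IsOscillator M K B)
    (hconst : ∀ (μ : ℂ) (v : Fin q → ℂ), μ.re = 0 → Γ *ᵥ v = μ • v → ∃ c : ℂ, v = c • 1) :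
    Synchronizes d r M K B := by
  intro x x' x'' u y z z' h i j
  obtain ⟨Q, hQ⟩ := exists_eq_transpose_mul_self hosc.posDef_K.posSemidef
  obtain ⟨N, hN⟩ := exists_eq_transpose_mul_self hosc.posDef_M.posSemidef
  obtain ⟨L, hL⟩ := exists_eq_transpose_mul_self hr.posSemidef_lap
  have hQu := isUnit_det_of_posDef hosc.posDef_K hQ
  have hNu := isUnit_det_of_posDef hosc.posDef_M hN
  let S := networkStates d r M K B
  let φ : S →ₗ[ℂ] _ := energyVec Q N L ∘ₗ
    ((LinearMap.fst ℂ _ _).prod ((LinearMap.fst ℂ _ _ ∘ₗ LinearMap.snd ℂ _ _).prod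
      (LinearMap.fst ℂ _ _ ∘ₗ LinearMap.snd ℂ _ _ ∘ₗ LinearMap.snd ℂ _ _ ∘ₗ LinearMap.snd ℂ _ _ ∘ₗ
        LinearMap.snd ℂ _ _))) ∘ₗ S.subtype
  let ψ : S →ₗ[ℂ] _ := energyVec Q N L ∘ₗ
    ((LinearMap.fst ℂ _ _ ∘ₗ LinearMap.snd ℂ _ _).prod
      ((LinearMap.fst ℂ _ _ ∘ₗ LinearMap.snd ℂ _ _ ∘ₗ LinearMap.snd ℂ _ _).prod
      (LinearMap.snd ℂ _ _ ∘ₗ LinearMap.snd ℂ _ _ ∘ₗ LinearMap.snd ℂ _ _ ∘ₗ LinearMap.snd ℂ _ _ ∘ₗ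
        LinearMap.snd ℂ _ _))) ∘ₗ S.subtype
  have hφ : ∀ s : S, φ s = energyVec Q N L (s.1.1, s.1.2.1, s.1.2.2.2.2.1) := fun s => rfl
  have hψ : ∀ s : S, ψ s = energyVec Q N L (s.1.2.1, s.1.2.2.1, s.1.2.2.2.2.2) := fun s => rfl
  have hpow : ∀ s : S, (star (φ s) ⬝ᵥ ψ s).re =
      -(star s.1.2.2.2.2.2 ⬝ᵥ (lap d).map Complex.ofReal *ᵥ s.1.2.2.2.2.2).re := by
    intro s
    rw [hφ, hψ, star_energyVec_dotProduct hQ hN hL, Complex.add_re, Complex.add_re]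
    exact s.2.power_balance hosc.posDef_K.posSemidef hr.posSemidef_lap
  -- the output `x i - x j`, recovered from the coordinates `Q x`
  let C₀ : ((Fin q × Fin n) ⊕ (Fin q × Fin n) ⊕ (Fin q ⊕ Fin m) → ℂ) →ₗ[ℂ] (Fin n → ℂ) :=
    { toFun := fun v => Q⁻¹.map Complex.ofReal *ᵥ fun k => v (Sum.inl (i, k)) - v (Sum.inl (j, k))
      map_add' := fun v w => by
        rw [← mulVec_add]
        congr 1
        ext k
        simp only [Pi.add_apply]
        ring
      map_smul' := fun c v => by
        rw [RingHom.id_apply, ← mulVec_smul]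
        congr 1
        ext k
        simp only [Pi.smul_apply, smul_eq_mul]
        ring }
  have hC₀ : ∀ s : S, C₀ (φ s) = s.1.1 i - s.1.1 j := by
    intro s
    have h1 : C₀ (φ s) = Q⁻¹.map Complex.ofReal *ᵥ
        (Q.map Complex.ofReal *ᵥ s.1.1 i - Q.map Complex.ofReal *ᵥ s.1.1 j) := rfl
    have h2 : Q⁻¹.map Complex.ofReal * Q.map Complex.ofReal = 1 := by
      rw [← map_ofReal_mul, nonsing_inv_mul _ hQu]
      ext k l
      simp [one_apply, apply_ite Complex.ofReal]
    rw [h1, ← mulVec_sub, mulVec_mulVec, h2, one_mulVec]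
  -- the time is cut off at `0` because the equations are only required for `t ≥ 0`
  have hmem : ∀ t : ℝ, ((fun i k => (x i (max t 0) k : ℂ), fun i k => (x' i (max t 0) k : ℂ),
      fun i k => (x'' i (max t 0) k : ℂ), fun i => (u i (max t 0) : ℂ),
      fun k => (z k (max t 0) : ℂ), fun k => (z' k (max t 0) : ℂ)) : NetworkVars q m n) ∈ S :=
    fun t => h.isNetworkState (le_max_right t 0)
  let s : ℝ → S := fun t => ⟨_, hmem t⟩
  have hmain := tendsto_of_dissipative φ ψ ?_ (LinearMap.toContinuousLinearMap C₀) ?_ s ?_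
  · simp only [LinearMap.coe_toContinuousLinearMap', hC₀] at hmain
    rw [← tendsto_zero_iff_norm_tendsto_zero, tendsto_pi_nhds]
    intro k
    have h1 := (Complex.continuous_re.tendsto _).comp (tendsto_pi_nhds.1 hmain k)
    refine h1.congr' ?_
    filter_upwards [eventually_ge_atTop 0] with t ht
    simp [s, max_eq_left ht]
  · intro s
    rw [hpow]
    exact neg_nonpos.2 (re_star_dotProduct_mulVec_nonneg hd.posSemidef_lap _)
  · intro μ s hμ hs
    rw [LinearMap.coe_toContinuousLinearMap', hC₀, sub_eq_zero]
    have hs' : ∀ k, ψ s k = μ * φ s k := fun k => congrFun hs k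
    refine IsNetworkState.eq_of_imaginary s.2 hd hr hΓ hosc hconst hμ ?_ ?_ ?_ ?_ i j
    · ext1 i
      refine map_mulVec_injective hQu ?_
      rw [Pi.smul_apply, mulVec_smul]
      exact funext fun k => hs' (Sum.inl (i, k))
    · ext1 i
      refine map_mulVec_injective hNu ?_
      rw [Pi.smul_apply, mulVec_smul]
      exact funext fun k => hs' (Sum.inr (Sum.inl (i, k)))
    · have h1 : L.map Complex.ofReal *ᵥ s.1.2.2.2.2.2 =
          μ • L.map Complex.ofReal *ᵥ s.1.2.2.2.2.1 := funext fun k => hs' (Sum.inr (Sum.inr k))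
      have h2 : (lap r).map Complex.ofReal = Lᵀ.map Complex.ofReal * L.map Complex.ofReal := by
        rw [hL, map_ofReal_mul]
      rw [h2, ← mulVec_mulVec, h1, mulVec_smul, mulVec_mulVec]
    · refine mulVec_eq_zero_of_re_eq_zero hd.posSemidef_lap ?_
      have h1 := hpow s
      rw [hs, dotProduct_smul, smul_eq_mul, Complex.mul_re, hμ, im_star_dotProduct_self] at h1
      linarith
  · intro t ht
    have hφs : ∀ t, 0 ≤ t → φ (s t) = energyVec Q N L (fun i k => (x i t k : ℂ),
        fun i k => (x' i t k : ℂ), fun k => (z k t : ℂ)) := fun t ht => by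
      simp only [hφ, s, max_eq_left ht]
    have hψs : ψ (s t) = energyVec Q N L (fun i k => (x' i t k : ℂ),
        fun i k => (x'' i t k : ℂ), fun k => (z' k t : ℂ)) := by
      simp only [hψ, s, max_eq_left ht]
    rw [hψs]
    refine HasDerivWithinAt.congr ?_ (fun t ht => hφs t ht) (hφs t ht)
    have hcast : ∀ {f : ℝ → ℝ} {f' : ℝ}, HasDerivWithinAt f f' (Set.Ici 0) t →
        HasDerivWithinAt (fun t => (f t : ℂ)) (f' : ℂ) (Set.Ici 0) t := fun hf => hf.ofReal_comp
    have hstate : HasDerivWithinAt (fun t => ((fun i k => (x i t k : ℂ), fun i k => (x' i t k : ℂ),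
        fun k => (z k t : ℂ)) : (Fin q → Fin n → ℂ) × (Fin q → Fin n → ℂ) × (Fin q ⊕ Fin m → ℂ)))
        (fun i k => (x' i t k : ℂ), fun i k => (x'' i t k : ℂ), fun k => (z' k t : ℂ))
        (Set.Ici 0) t := by
      refine HasDerivWithinAt.prodMk ?_ (HasDerivWithinAt.prodMk ?_ ?_)
      · exact hasDerivWithinAt_pi.2 fun i => hasDerivWithinAt_pi.2 fun k =>
          hcast (hasDerivWithinAt_pi.1 (h.deriv_x i t ht) k)
      · exact hasDerivWithinAt_pi.2 fun i => hasDerivWithinAt_pi.2 fun k =>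
          hcast (hasDerivWithinAt_pi.1 (h.deriv_x' i t ht) k)
      · exact hasDerivWithinAt_pi.2 fun k => hcast (h.deriv_z k t ht)
    exact ((LinearMap.toContinuousLinearMap (energyVec Q N L)).restrictScalars
      ℝ).hasFDerivAt.comp_hasDerivWithinAt t hstate

end SufficientCondition

end OscNet

theorem theorem1 (q m : ℕ) (hq : 1 ≤ q)
    (d r : Fin q ⊕ Fin m → Fin q ⊕ Fin m → ℝ)
    (hd : OscNet.IsWeight d) (hr : OscNet.IsWeight r) :
    (∃! Γ : Matrix (Fin q) (Fin q) ℂ, OscNet.IsSchurComplement (OscNet.complexLap d r) Γ) ∧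
    ∀ Γ : Matrix (Fin q) (Fin q) ℂ, OscNet.IsSchurComplement (OscNet.complexLap d r) Γ →
      ∀ (n : ℕ) (M K : Matrix (Fin n) (Fin n) ℝ) (B : Matrix (Fin n) (Fin 1) ℝ),
        OscNet.IsOscillator M K B →
          (∀ hq2 : 2 ≤ q, OscNet.Synchronizes d r M K B ↔ 0 < OscNet.reEig Γ ⟨1, hq2⟩) ∧
          (OscNet.Synchronizes d r M K B ↔ OscNet.numImagEig Γ = 1) := by
  refine ⟨OscNet.existsUnique_isSchurComplement hd hr, fun Γ hΓ n M K B hosc => ?_⟩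
  have : NeZero q := ⟨by omega⟩
  have hre := OscNet.re_star_dotProduct_schur hd hr hΓ
  have hone := OscNet.schur_mulVec_one hd hr hΓ
  have key : OscNet.Synchronizes d r M K B ↔ OscNet.numImagEig Γ = 1 := by
    rw [OscNet.numImagEig_eq_one_iff hre hone]
    exact ⟨fun h _ _ hμ hv => h.eq_smul_one hq hd hr hΓ hosc hμ hv,
      OscNet.synchronizes_of_forall_eq_smul_one hd hr hΓ hosc⟩
  exact ⟨fun hq2 => key.trans (OscNet.reEig_one_pos_iff hre hone hq2).symm, key⟩
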